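/- The \emph{length} $l(S)$ of a finite semigroup $S$ is the largest number of non-empty subsemigroups of $S$ in a chain (with respect to inclusion), minus $1$. For $n\ge 0$ consider the following finite monoids. \begin{itemize} \item $I_n$, the symmetric inverse monoid: all injective partial maps from $\{1,\dots,n\}$ to itself, under composition of partial maps. \item $I_n^*$, the dual symmetric inverse monoid: all bijections $\alpha\colon X/\rho\to X/\sigma$ between quotient sets of $X=\{1,\dots,n\}$ (block bijections), where the product of $\alpha\colon X/\rho\to X/\sigma$ and $\beta\colon X/\tau\to X/\upsilon$ is obtained by composing the bijections that $\alpha$ and $\beta$ induce when $\sigma$ and $\tau$ are both replaced by their join $\sigma\vee\tau$. \item $POI_n$: the submonoid of $I_n$ of all order-preserving injective partial maps. \item $POPI_n$: the submonoid of $I_n$ of all orientation-preserving injective partial maps, that is, all $f\in I_n$ with domain $\{a_1<\dots<a_k\}$ such that $(a_1f,\dots,a_kf)$ is a cyclic shift of an increasing sequence. \end{itemize} If $S_n$ denotes any one of the four families $I_n$, $I_n^*$, $POI_n$, $POPI_n$, then $$\lim_{n\to\infty}\frac{l(S_n)}{|S_n|}=\frac12 .$$ -/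

import Mathlib

open Filter Topology

/-! ### Length of a semigroup -/

/-- The length `l(S)` of a finite semigroup `S`: the largest number of non-empty subsemigroups of
`S` in a chain (with respect to inclusion), minus `1`. -/
noncomputable def semigroupLength (S : Type*) [Mul S] : ℤ :=
  (({T : Subsemigroup S | (T : Set S).Nonempty}.chainHeight (· ≤ ·)).toNat : ℤ) - 1

/-! ### The symmetric inverse monoid -/

/-- The symmetric inverse monoid `I_n`: the injective partial maps (partial permutations) of an
`n`-element set, here the chain `Fin n`. -/
def SymInvMonoid (n : ℕ) : Type := Fin n ≃. Fin n

/-- The product of `I_n` is composition of partial maps, written from left to right. -/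
instance SymInvMonoid.instMonoid (n : ℕ) : Monoid (SymInvMonoid n) where
  mul f g := PEquiv.trans f g
  one := PEquiv.refl (Fin n)
  mul_assoc f g h := PEquiv.trans_assoc f g h
  one_mul f := PEquiv.refl_trans f
  mul_one f := PEquiv.trans_refl f

/-- The (partial) value of `f` at `a`; it is `none` outside the domain of `f`. -/
def SymInvMonoid.app {n : ℕ} (f : SymInvMonoid n) (a : Fin n) : Option (Fin n) :=
  PEquiv.toFun f a

theorem SymInvMonoid.one_app {n : ℕ} (a : Fin n) : (1 : SymInvMonoid n).app a = some a := rfl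

theorem SymInvMonoid.mul_app {n : ℕ} (f g : SymInvMonoid n) (a : Fin n) :
    (f * g).app a = (f.app a).bind g.app := rfl

theorem SymInvMonoid.app_inj {n : ℕ} (f : SymInvMonoid n) {a b c : Fin n}
    (ha : f.app a = some c) (hb : f.app b = some c) : a = b :=
  PEquiv.inj (f : Fin n ≃. Fin n) (b := c) ha hb

instance SymInvMonoid.instFinite (n : ℕ) : Finite (SymInvMonoid n) :=
  Finite.of_injective (fun f : SymInvMonoid n => f.app) fun _ _ h =>
    PEquiv.ext fun x => congrFun h x

/-! ### Order-preserving partial injections -/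

/-- `POI_n`: the submonoid of `I_n` of all order-preserving injective partial maps. -/
def POI (n : ℕ) : Submonoid (SymInvMonoid n) where
  carrier := {f | ∀ a b a' b', f.app a = some a' → f.app b = some b' → a < b → a' < b'}
  one_mem' := by
    intro a b a' b' ha hb hab
    rw [SymInvMonoid.one_app, Option.some_inj] at ha hb
    exact ha ▸ hb ▸ hab
  mul_mem' := by
    intro f g hf hg a b a' b' ha hb hab
    rw [SymInvMonoid.mul_app, Option.bind_eq_some_iff] at ha hb
    obtain ⟨x, hx, hx'⟩ := ha
    obtain ⟨y, hy, hy'⟩ := hb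
    exact hg _ _ _ _ hx' hy' (hf _ _ _ _ hx hy hab)

/-! ### Orientation-preserving partial injections -/

/-- The image sequence `(a₁ f, …, aₖ f)` of a partial injection `f` with domain
`{a₁ < ⋯ < aₖ}`. -/
def SymInvMonoid.imageSeq {n : ℕ} (f : SymInvMonoid n) : List (Fin n) :=
  (List.finRange n).filterMap f.app

/-- An injective partial map of the chain is orientation-preserving if its image sequence is
cyclic, that is, a cyclic shift of an increasing sequence. -/
def SymInvMonoid.IsOrientationPreserving {n : ℕ} (f : SymInvMonoid n) : Prop :=
  ∃ r : ℕ, (f.imageSeq.rotate r).Pairwise (· < ·)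

/-- `x, y, z` are distinct and occur in this cyclic order. -/
def CyclicTriple {n : ℕ} (x y z : Fin n) : Prop :=
  (x < y ∧ y < z) ∨ (y < z ∧ z < x) ∨ (z < x ∧ x < y)

theorem exists_rotate_pairwise_lt_iff {n : ℕ} (l : List (Fin n)) (hl : l.Nodup) :
    (∃ r : ℕ, (l.rotate r).Pairwise (· < ·)) ↔
      ∀ x y z, [x, y, z].Sublist l → CyclicTriple x y z := by
  constructor
  · rintro ⟨r, hr⟩ x y z h
    rw [List.rotate_eq_drop_append_take_mod] at hr
    rw [← List.take_append_drop (r % l.length) l] at h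
    obtain ⟨l₁, l₂, e, h₁, h₂⟩ := List.sublist_append_iff.1 h
    have hp := hr.sublist (h₂.append h₁)
    unfold CyclicTriple
    rcases l₁ with _ | ⟨p, _ | ⟨q, _ | ⟨s, t⟩⟩⟩
    · simp at e; subst e; simp at hp; tauto
    · simp at e; obtain ⟨rfl, rfl⟩ := e; simp at hp; tauto
    · simp at e; obtain ⟨rfl, rfl, rfl⟩ := e; simp at hp; tauto
    · simp at e; obtain ⟨rfl, rfl, rfl, rfl, rfl⟩ := e; simp at hp; tauto
  · intro h
    by_cases hne : l = []
    · exact ⟨0, by simp [hne]⟩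
    obtain ⟨m, hm, hmin⟩ : ∃ m ∈ l, ∀ x ∈ l, m ≤ x := by
      obtain ⟨m, hm, hmin⟩ := l.toFinset.exists_min_image id (List.toFinset_nonempty_iff _ |>.2 hne)
      exact ⟨m, by simpa using hm, by simpa using hmin⟩
    obtain ⟨u, v, rfl⟩ := List.append_of_mem hm
    refine ⟨u.length, ?_⟩
    rw [List.rotate_append_length_eq]
    have hlt : ∀ x ∈ u ++ v, m < x := by
      intro x hx
      refine lt_of_le_of_ne (hmin x ?_) ?_
      · simp only [List.mem_append, List.mem_cons] at hx ⊢; tauto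
      · rintro rfl
        exact (List.nodup_middle.1 hl).notMem hx
    rw [List.cons_append, List.pairwise_cons]
    refine ⟨fun x hx => hlt x (by simp only [List.mem_append] at hx ⊢; tauto), ?_⟩
    rw [List.pairwise_append]
    refine ⟨?_, ?_, ?_⟩
    · rw [List.pairwise_iff_forall_sublist]
      intro y z hyz
      have h1 := h m y z ((hyz.cons_cons m).trans (List.sublist_append_right u _))
      have h2 := hlt y (by simpa using Or.inr (hyz.subset (by simp)))
      have h3 := hlt z (by simpa using Or.inr (hyz.subset (by simp)))
      unfold CyclicTriple at h1
      omega
    · rw [List.pairwise_iff_forall_sublist]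
      intro y z hyz
      have h1 := h y z m (hyz.append (List.singleton_sublist.2 (by simp : m ∈ m :: v)))
      have h2 := hlt y (by simpa using Or.inl (hyz.subset (by simp)))
      have h3 := hlt z (by simpa using Or.inl (hyz.subset (by simp)))
      unfold CyclicTriple at h1
      omega
    · intro y hy z hz
      have h1 := h z m y ((List.singleton_sublist.2 hz).append
        ((List.singleton_sublist.2 hy).cons_cons m))
      have h2 := hlt y (by simp [hy])
      have h3 := hlt z (by simp [hz])
      unfold CyclicTriple at h1
      omega

/-- A partial injection is orientation-preserving iff it preserves the cyclic order of triples. -/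
theorem SymInvMonoid.isOrientationPreserving_iff {n : ℕ} (f : SymInvMonoid n) :
    f.IsOrientationPreserving ↔ ∀ a b c a' b' c', f.app a = some a' → f.app b = some b' →
      f.app c = some c' → CyclicTriple a b c → CyclicTriple a' b' c' := by
  have hnd : f.imageSeq.Nodup :=
    (List.nodup_finRange n).filterMap fun a b c ha hb => f.app_inj ha hb
  unfold SymInvMonoid.IsOrientationPreserving
  rw [exists_rotate_pairwise_lt_iff _ hnd]
  constructor
  · intro h
    have key : ∀ a b c a' b' c', f.app a = some a' → f.app b = some b' →
        f.app c = some c' → a < b → b < c → CyclicTriple a' b' c' := by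
      intro a b c a' b' c' ha hb hc hab hbc
      apply h
      have hs : [a, b, c].Sublist (List.finRange n) := by
        apply List.sublist_of_subperm_of_pairwise (r := (· < ·))
        · exact List.subperm_of_subset (by simp [hab.ne, hbc.ne, (hab.trans hbc).ne])
            (fun x _ => List.mem_finRange x)
        · simp [hab, hbc, hab.trans hbc]
        · exact List.pairwise_lt_finRange n
      simpa [SymInvMonoid.imageSeq, List.filterMap_cons, ha, hb, hc] using hs.filterMap f.app
    rintro a b c a' b' c' ha hb hc (⟨h1, h2⟩ | ⟨h1, h2⟩ | ⟨h1, h2⟩)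
    · exact key _ _ _ _ _ _ ha hb hc h1 h2
    · have := key _ _ _ _ _ _ hb hc ha h1 h2
      unfold CyclicTriple at *; tauto
    · have := key _ _ _ _ _ _ hc ha hb h1 h2
      unfold CyclicTriple at *; tauto
  · intro h x y z hs
    obtain ⟨l', hl', e⟩ := List.sublist_filterMap_iff.1 hs
    obtain ⟨l₁, a, t₁, rfl, -, ha, e⟩ := List.filterMap_eq_cons_iff.1 e.symm
    obtain ⟨l₂, b, t₂, rfl, -, hb, e⟩ := List.filterMap_eq_cons_iff.1 e
    obtain ⟨l₃, c, t₃, rfl, -, hc, e⟩ := List.filterMap_eq_cons_iff.1 e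
    have hp := (List.pairwise_lt_finRange n).sublist hl'
    simp only [List.pairwise_append, List.pairwise_cons, List.mem_append, List.mem_cons] at hp
    have hab : a < b := hp.2.1.1 b (by simp)
    have hbc : b < c := hp.2.1.2.2.1.1 c (by simp)
    exact h a b c x y z ha hb hc (Or.inl ⟨hab, hbc⟩)

/-- `POPI_n`: the submonoid of `I_n` of all orientation-preserving injective partial maps. -/
def POPI (n : ℕ) : Submonoid (SymInvMonoid n) where
  carrier := {f | f.IsOrientationPreserving}
  one_mem' := by
    refine (SymInvMonoid.isOrientationPreserving_iff _).2 ?_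
    intro a b c a' b' c' ha hb hc h
    rw [SymInvMonoid.one_app, Option.some_inj] at ha hb hc
    exact ha ▸ hb ▸ hc ▸ h
  mul_mem' := by
    intro f g hf hg
    refine (SymInvMonoid.isOrientationPreserving_iff _).2 ?_
    intro a b c a' b' c' ha hb hc h
    rw [SymInvMonoid.mul_app, Option.bind_eq_some_iff] at ha hb hc
    obtain ⟨x, hx, hx'⟩ := ha
    obtain ⟨y, hy, hy'⟩ := hb
    obtain ⟨z, hz, hz'⟩ := hc
    exact (SymInvMonoid.isOrientationPreserving_iff _).1 hg _ _ _ _ _ _ hx' hy' hz'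
      ((SymInvMonoid.isOrientationPreserving_iff _).1 hf _ _ _ _ _ _ hx hy hz h)

/-! ### The dual symmetric inverse monoid -/

/-- A block bijection of `X = Fin n`, that is, a bijection `X/ρ → X/σ` between two quotient sets
of `X`. It is encoded by the relation `rel x y` which says that the `ρ`-class of `x` is mapped to
the `σ`-class of `y`; the relations arising are the biequivalences: the relations which are total
on both sides and difunctional. -/
@[ext]
structure DualSymInvMonoid (n : ℕ) where
  rel : Fin n → Fin n → Prop
  left_total : ∀ x, ∃ y, rel x y
  right_total : ∀ y, ∃ x, rel x y
  difunctional : ∀ {x y x' y'}, rel x y → rel x' y → rel x' y' → rel x y'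

namespace DualSymInvMonoid

variable {n : ℕ}

/-- The equivalence `ρ` of a block bijection `X/ρ → X/σ`. -/
def dom (α : DualSymInvMonoid n) : Setoid (Fin n) where
  r x x' := ∃ y, α.rel x y ∧ α.rel x' y
  iseqv :=
    ⟨fun x => (α.left_total x).imp fun _ h => ⟨h, h⟩, fun ⟨y, h, h'⟩ => ⟨y, h', h⟩,
      fun ⟨y, h, h'⟩ ⟨_, k, k'⟩ => ⟨y, h, α.difunctional k' k h'⟩⟩

/-- The equivalence `σ` of a block bijection `X/ρ → X/σ`. -/
def cod (α : DualSymInvMonoid n) : Setoid (Fin n) where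
  r y y' := ∃ x, α.rel x y ∧ α.rel x y'
  iseqv :=
    ⟨fun y => (α.right_total y).imp fun _ h => ⟨h, h⟩, fun ⟨x, h, h'⟩ => ⟨x, h', h⟩,
      fun ⟨x, h, h'⟩ ⟨_, k, k'⟩ => ⟨x, h, α.difunctional h' k k'⟩⟩

/-- The product of block bijections `α : X/ρ → X/σ` and `β : X/τ → X/υ`: both are extended to
the join `σ ⊔ τ` in the middle, and then composed from left to right. -/
def comp (α β : DualSymInvMonoid n) : DualSymInvMonoid n where
  rel x z := ∃ y y', α.rel x y ∧ (α.cod ⊔ β.dom) y y' ∧ β.rel y' z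
  left_total x := by
    obtain ⟨y, hy⟩ := α.left_total x
    obtain ⟨z, hz⟩ := β.left_total y
    exact ⟨z, y, y, hy, (α.cod ⊔ β.dom).refl y, hz⟩
  right_total z := by
    obtain ⟨y, hy⟩ := β.right_total z
    obtain ⟨x, hx⟩ := α.right_total y
    exact ⟨x, y, y, hx, (α.cod ⊔ β.dom).refl y, hy⟩
  difunctional := by
    rintro x z x' z' ⟨y, y', h1, h2, h3⟩ ⟨w, w', k1, k2, k3⟩ ⟨v, v', m1, m2, m3⟩
    refine ⟨y, v', h1, ?_, m3⟩
    have e1 : (α.cod ⊔ β.dom) y' w' := (le_sup_right : β.dom ≤ _) ⟨z, h3, k3⟩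
    have e2 : (α.cod ⊔ β.dom) w v := (le_sup_left : α.cod ≤ _) ⟨x', k1, m1⟩
    exact Setoid.trans' _ h2 (Setoid.trans' _ e1 (Setoid.trans' _ (Setoid.symm' _ k2)
      (Setoid.trans' _ e2 m2)))

theorem comp_of_rel {α β : DualSymInvMonoid n} {x y z : Fin n} (h : α.rel x y) (k : β.rel y z) :
    (comp α β).rel x z :=
  ⟨y, y, h, (α.cod ⊔ β.dom).refl y, k⟩

/-- The product is the least difunctional relation containing the composite relation. -/
theorem comp_least (α β : DualSymInvMonoid n) (P : Fin n → Fin n → Prop)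
    (hP : ∀ {x y x' y'}, P x y → P x' y → P x' y' → P x y')
    (hc : ∀ {x y z}, α.rel x y → β.rel y z → P x z) {x z : Fin n}
    (h : (comp α β).rel x z) : P x z := by
  let N : Setoid (Fin n) :=
    { r := fun y y' => ∀ x z, α.rel x y → β.rel y' z → P x z
      iseqv := by
        refine ⟨fun y x z h k => hc h k, ?_, ?_⟩
        · intro y y' h x z hx hz
          obtain ⟨x₀, hx₀⟩ := α.right_total y
          obtain ⟨z₀, hz₀⟩ := β.left_total y'
          exact hP (hc hx hz₀) (h _ _ hx₀ hz₀) (hc hx₀ hz)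
        · intro y y' y'' h k x z hx hz
          obtain ⟨x₀, hx₀⟩ := α.right_total y'
          obtain ⟨z₀, hz₀⟩ := β.left_total y'
          exact hP (h _ _ hx hz₀) (hc hx₀ hz₀) (k _ _ hx₀ hz) }
  have hN : α.cod ⊔ β.dom ≤ N := by
    refine sup_le ?_ ?_
    · rintro y y' ⟨a, h1, h2⟩ x z hx hz
      exact hc (α.difunctional hx h1 h2) hz
    · rintro y y' ⟨a, h1, h2⟩ x z hx hz
      exact hc hx (β.difunctional h1 h2 hz)
  obtain ⟨y, y', h1, h2, h3⟩ := h
  exact hN h2 x z h1 h3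

theorem ext_iff' {α β : DualSymInvMonoid n} (h : ∀ x y, α.rel x y ↔ β.rel x y) : α = β :=
  DualSymInvMonoid.ext (funext fun x => funext fun y => propext (h x y))

/-- The dual symmetric inverse monoid `I_n^*` of all block bijections of an `n`-element set. -/
instance instMonoid (n : ℕ) : Monoid (DualSymInvMonoid n) where
  mul := comp
  one :=
    { rel := fun x y => x = y
      left_total := fun x => ⟨x, rfl⟩
      right_total := fun x => ⟨x, rfl⟩
      difunctional := fun h k m => h.trans (k.symm.trans m) }
  mul_assoc α β γ := by
    refine ext_iff' fun x w => ⟨fun h => ?_, fun h => ?_⟩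
    · refine comp_least (comp α β) γ (comp α (comp β γ)).rel
        (comp α (comp β γ)).difunctional (fun {x y z} hxy hyz => ?_) h
      refine comp_least α β (fun x y => ∀ z, γ.rel y z → (comp α (comp β γ)).rel x z)
        (fun {a b c d} h1 h2 h3 z hz => ?_)
        (fun {a b c} h1 h2 z hz => comp_of_rel h1 (comp_of_rel h2 hz)) hxy z hyz
      obtain ⟨e, he⟩ := γ.left_total b
      exact (comp α (comp β γ)).difunctional (h1 e he) (h2 e he) (h3 z hz)
    · refine comp_least α (comp β γ) (comp (comp α β) γ).rel
        (comp (comp α β) γ).difunctional (fun {x y z} hxy hyz => ?_) h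
      refine comp_least β γ (fun y z => ∀ x, α.rel x y → (comp (comp α β) γ).rel x z)
        (fun {a b c d} h1 h2 h3 x hx => ?_)
        (fun {a b c} h1 h2 x hx => comp_of_rel (comp_of_rel hx h1) h2) hyz x hxy
      obtain ⟨e, he⟩ := α.right_total c
      exact (comp (comp α β) γ).difunctional (h1 x hx) (h2 e he) (h3 e he)
  one_mul α := by
    refine ext_iff' fun x z => ⟨fun h => ?_, fun h => comp_of_rel (y := x) rfl h⟩
    refine comp_least _ α α.rel α.difunctional (fun {x y z} hxy hyz => ?_) h
    have e : x = y := hxy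
    exact e ▸ hyz
  mul_one α := by
    refine ext_iff' fun x z => ⟨fun h => ?_, fun h => comp_of_rel (y := z) h rfl⟩
    refine comp_least α _ α.rel α.difunctional (fun {x y z} hxy hyz => ?_) h
    have e : y = z := hyz
    exact e ▸ hxy

instance instFinite (n : ℕ) : Finite (DualSymInvMonoid n) :=
  Finite.of_injective (fun α : DualSymInvMonoid n => α.rel) fun _ _ h => DualSymInvMonoid.ext h

end DualSymInvMonoid

/-! ### Comparing equivalence relations by their number of classes -/

/-! Each of these monoids is a finite inverse semigroup, read here as a groupoid: s is an arrow from
its domain to its image. Composable products are groupoid compositions, and every other product has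
smaller rank than one of its factors. Number the objects; let U be the number of arrows going up and
L the number of loops. Inversion swaps up and down, so |S| = 2U + L. The claim reduces to l(S) = U +
O(L) and L = o(|S|).

Lower bound: order elements by rank, then by the displacement idx(d) - idx(r). Displacements add
under composition, so below an upward arrow, whose displacement is negative, a product only moves
further down in this order. Initial segments ending at upward arrows are thus a chain of U
subsemigroups (`card_upper_le_semigroupLength`).

Upper bound: for distinct objects e, f, a subsemigroup T with arrows both ways has equally many each
way. So T is measured by the larger of the two counts for each pair, plus its loops, plus a term for
how many objects it has connected. This `potential` strictly increases with T and never exceeds U +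
L + |E| ≤ U + 2L.

Loops are rare: if e is joined to m objects, composing the loops at e with one arrow to each target
gives m times as many arrows (`mul_ncard_loops_le`). Every object except the two of extreme rank
shares its rank with about n others. One extreme object carries a single loop; the other carries
only permutations, and restricting these at a point, or merging two points, produces about n times
as many elements up to a bounded factor. -/

theorem Setoid.card_quotient_le_of_le {α : Type*} [Finite α] {r r' : Setoid α} (h : r ≤ r') :
    Nat.card (Quotient r') ≤ Nat.card (Quotient r) :=
  Nat.card_le_card_of_surjective (Quotient.map' (s₁ := r) (s₂ := r') id h)
    (Quotient.ind fun a => ⟨Quotient.mk r a, rfl⟩)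

theorem Setoid.card_quotient_lt_of_le {α : Type*} [Finite α] {r r' : Setoid α} (h : r ≤ r') {a b : α}
    (hab : r' a b) (hab' : ¬ r a b) : Nat.card (Quotient r') < Nat.card (Quotient r) := by
  classical
  have := Fintype.ofFinite α
  rw [Nat.card_eq_fintype_card, Nat.card_eq_fintype_card]
  refine Fintype.card_lt_of_surjective_not_injective
    (Quotient.map' (s₁ := r) (s₂ := r') id h)
    (Quotient.ind fun a => ⟨Quotient.mk r a, rfl⟩) fun hinj => hab' ?_
  exact Quotient.exact (hinj (Quotient.sound hab : Quotient.mk r' a = Quotient.mk r' b) :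
    Quotient.mk r a = Quotient.mk r b)

theorem Setoid.eq_of_le_of_card_quotient_eq {X : Type*} [Finite X] {r r' : Setoid X} (h : r ≤ r')
    (hc : Nat.card (Quotient r') = Nat.card (Quotient r)) : r = r' := by
  refine le_antisymm h fun a b hab => ?_
  by_contra hab'
  exact (Setoid.card_quotient_lt_of_le h hab hab').ne hc

/-! ### Length of a finite graded semigroup with a groupoid structure -/

/-- A finite inverse semigroup seen through its groupoid: each element is an arrow from `d s` to
`r s`, the product of composable elements is the composition of the groupoid, and all other
products have a smaller rank than one of the factors. -/
structure GroupoidGrading (S : Type*) [Mul S] (E : Type*) where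
  /-- The source of an element. -/
  d : S → E
  /-- The target of an element. -/
  r : S → E
  /-- The inverse of an element. -/
  inv : S → S
  /-- The rank of an element. -/
  rank : S → ℕ
  d_mul : ∀ {s t}, r s = d t → d (s * t) = d s
  r_mul : ∀ {s t}, r s = d t → r (s * t) = r t
  d_inv : ∀ s, d (inv s) = r s
  r_inv : ∀ s, r (inv s) = d s
  inv_inv : ∀ s, inv (inv s) = s
  inv_mul_cancel : ∀ {s t}, r s = d t → inv s * (s * t) = t
  mul_inv_cancel : ∀ {s t}, r t = d s → (t * s) * inv s = t
  rank_mul_left : ∀ s t, rank (s * t) ≤ rank s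
  rank_mul_right : ∀ s t, rank (s * t) ≤ rank t
  composable : ∀ {s t}, rank (s * t) = rank s → rank (s * t) = rank t → r s = d t
  exists_unit : ∀ e, ∃ s, d s = e ∧ r s = e

/-- A strictly monotone Φ is injective on a chain and takes at most B + 1 values. -/
theorem semigroupLength_le_of_strictMono {S : Type*} [Mul S] [Finite S]
    (Φ : Subsemigroup S → ℕ) (B : ℕ) (hΦ : StrictMono Φ) (hB : ∀ T, Φ T ≤ B) :
    semigroupLength S ≤ B := by
  classical
  have : Finite (Subsemigroup S) := Finite.of_injective _ SetLike.coe_injective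
  obtain ⟨t, -, ht, hc⟩ := Set.exists_eq_chainHeight_of_finite
    {T : Subsemigroup S | (T : Set S).Nonempty} (· ≤ ·) (Set.toFinite _)
  have hinj : Set.InjOn Φ t := by
    intro a ha b hb hab
    by_contra hne
    rcases hc ha hb hne with h | h
    · exact (hΦ (lt_of_le_of_ne h hne)).ne hab
    · exact (hΦ (lt_of_le_of_ne h (Ne.symm hne))).ne hab.symm
  have h1 : t.ncard ≤ B + 1 := by
    rw [← hinj.ncard_image]
    have : Φ '' t ⊆ (Finset.range (B + 1) : Set ℕ) := by
      rintro _ ⟨a, -, rfl⟩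
      simpa using Nat.lt_succ_of_le (hB a)
    simpa [Set.ncard_coe_finset] using Set.ncard_le_ncard this (Finset.finite_toSet _)
  unfold semigroupLength
  rw [← ht]
  change ((t.ncard : ℕ) : ℤ) - 1 ≤ B
  omega

theorem le_semigroupLength_of_isChain {S : Type*} [Mul S] [Finite S] {ι : Type*} [Finite ι]
    (T : ι → Subsemigroup S) (hT : Function.Injective T) (hne : ∀ i, (T i : Set S).Nonempty)
    (hc : ∀ i j, T i ≤ T j ∨ T j ≤ T i) :
    (Nat.card ι : ℤ) - 1 ≤ semigroupLength S := by
  classical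
  have : Finite (Subsemigroup S) := Finite.of_injective _ SetLike.coe_injective
  have h := Set.encard_le_chainHeight_of_isChain (r := (· ≤ ·))
    {T : Subsemigroup S | (T : Set S).Nonempty} (Set.range T)
    (by rintro _ ⟨i, rfl⟩; exact hne i)
    (by rintro _ ⟨i, rfl⟩ _ ⟨j, rfl⟩ -; exact hc i j)
  -- Finiteness matters here: `toNat` would turn an infinite chain height into 0.
  have h2 := ENat.toNat_le_toNat h (Set.chainHeight_ne_top_of_finite _ _ (Set.toFinite _))
  have h3 : (Set.range T).encard.toNat = Nat.card ι := by
    change (Set.range T).ncard = _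
    rw [← Set.image_univ, Set.ncard_image_of_injective _ hT, Set.ncard_univ]
  unfold semigroupLength
  omega

/-! ### Lower bound: a chain indexed by the upward arrows -/

namespace GroupoidGrading

variable {S E : Type*} [Mul S] (G : GroupoidGrading S E)

theorem mul_left_injective {s t u : S} (ht : G.r s = G.d t) (hu : G.r s = G.d u)
    (h : s * t = s * u) : t = u := by
  rw [← G.inv_mul_cancel ht, h, G.inv_mul_cancel hu]

theorem mul_right_injective {s t u : S} (ht : G.r t = G.d s) (hu : G.r u = G.d s)
    (h : t * s = u * s) : t = u := by
  rw [← G.mul_inv_cancel ht, h, G.mul_inv_cancel hu]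

/-- The elements whose source comes before their target in the order given by `idx`. -/
def upper (idx : E → ℕ) : Set S := {s | idx (G.d s) < idx (G.r s)}

/-- The elements lying in a subgroup. -/
def loops : Set S := {s | G.d s = G.r s}

theorem mem_upper {idx : E → ℕ} {s : S} :
    s ∈ G.upper idx ↔ idx (G.d s) < idx (G.r s) := Iff.rfl

theorem mem_loops {s : S} : s ∈ G.loops ↔ G.d s = G.r s := Iff.rfl

/-- Inversion exchanges upward and downward arrows; by injectivity of `idx`, an arrow that is
neither is a loop. -/
theorem card_eq [Finite S] {idx : E → ℕ} (hidx : Function.Injective idx) :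
    Nat.card S = 2 * (G.upper idx).ncard + G.loops.ncard := by
  have h1 : (G.inv '' G.upper idx).ncard = (G.upper idx).ncard :=
    Set.ncard_image_of_injective _ (Function.LeftInverse.injective (g := G.inv) G.inv_inv)
  have h2 : G.inv '' G.upper idx = {s | idx (G.r s) < idx (G.d s)} := by
    ext s
    constructor
    · rintro ⟨t, ht, rfl⟩
      simpa [upper, G.d_inv, G.r_inv] using ht
    · intro hs
      exact ⟨G.inv s, by simpa [upper, G.d_inv, G.r_inv] using hs, G.inv_inv s⟩
  have h3 : (Set.univ : Set S) = (G.upper idx ∪ G.inv '' G.upper idx) ∪ G.loops := by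
    rw [h2]
    ext s
    have : G.d s = G.r s ↔ idx (G.d s) = idx (G.r s) := hidx.eq_iff.symm
    simp only [upper, loops, Set.mem_univ, Set.mem_union, Set.mem_ofPred_eq, this, true_iff]
    omega
  rw [← Set.ncard_univ, h3, Set.ncard_union_eq _ (Set.toFinite _) (Set.toFinite _),
    Set.ncard_union_eq _ (Set.toFinite _) (Set.toFinite _), h1, two_mul]
  · rw [h2, Set.disjoint_left]
    intro s h k
    simp only [upper, Set.mem_ofPred_eq] at h k
    omega
  · rw [h2, Set.disjoint_left]
    intro s h k
    simp only [loops, upper, Set.mem_union, Set.mem_ofPred_eq] at h k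
    rw [k] at h
    omega

/-- A linear order of the elements (by rank, then from the elements moving furthest upwards to
those moving furthest downwards) whose initial segments below upper elements are subsemigroups. -/
noncomputable def key [Finite S] (idx : E → ℕ) (s : S) : ℕ ×ₗ ℤ ×ₗ Fin (Nat.card S) :=
  toLex (G.rank s, toLex ((idx (G.d s) : ℤ) - idx (G.r s), Finite.equivFin S s))

theorem key_injective [Finite S] (idx : E → ℕ) : Function.Injective (G.key idx) := by
  intro s t h
  simp only [key, EmbeddingLike.apply_eq_iff_eq, Prod.mk.injEq] at h
  exact h.2.2

theorem key_mul_le [Finite S] (idx : E → ℕ) {s t u : S} (hs : s ∈ G.upper idx)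
    (ht : G.key idx t ≤ G.key idx s) (hu : G.key idx u ≤ G.key idx s) :
    G.key idx (t * u) ≤ G.key idx s := by
  have h1 := G.rank_mul_left t u
  have h2 := G.rank_mul_right t u
  simp only [upper, Set.mem_ofPred_eq] at hs
  simp only [key, Prod.Lex.toLex_le_toLex] at ht hu ⊢
  by_cases hlt : G.rank (t * u) < G.rank s
  · exact Or.inl hlt
  have ht1 : G.rank t = G.rank s := by omega
  have hu1 : G.rank u = G.rank s := by omega
  have hc : G.r t = G.d u := G.composable (by omega) (by omega)
  right
  -- The displacement of `t * u` is the sum of those of `t` and `u`. Both are at most that of `s`,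
  -- which is negative, so the sum is strictly smaller and the tie-breaking coordinate plays no
  -- role.
  refine ⟨by omega, Or.inl ?_⟩
  rw [G.d_mul hc, G.r_mul hc]
  rw [hc] at ht
  omega

theorem card_upper_le_semigroupLength [Finite S] (idx : E → ℕ) :
    ((G.upper idx).ncard : ℤ) - 1 ≤ semigroupLength S := by
  let T : G.upper idx → Subsemigroup S := fun s =>
    { carrier := {t | G.key idx t ≤ G.key idx s}
      mul_mem' := fun ht hu => G.key_mul_le idx s.2 ht hu }
  refine le_semigroupLength_of_isChain T ?_ ?_ ?_
  · intro s s' h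
    have h1 : (s : S) ∈ T s' := h ▸ (le_refl (G.key idx s) : (s : S) ∈ T s)
    have h2 : (s' : S) ∈ T s := h ▸ (le_refl (G.key idx s') : (s' : S) ∈ T s')
    exact Subtype.ext (G.key_injective idx (le_antisymm h1 h2))
  · exact fun s => ⟨s, le_refl (G.key idx s)⟩
  · intro s s'
    rcases le_total (G.key idx s) (G.key idx s') with h | h
    · exact Or.inl fun t ht => le_trans (α := ℕ ×ₗ ℤ ×ₗ Fin (Nat.card S)) ht h
    · exact Or.inr fun t ht => le_trans (α := ℕ ×ₗ ℤ ×ₗ Fin (Nat.card S)) ht h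

end GroupoidGrading

/-! ### Upper bound: a potential on subsemigroups -/

namespace GroupoidGrading

variable {S E : Type*} [Mul S] (G : GroupoidGrading S E)

open Classical in
/-- The elements of `T` from `e` to `f`. -/
noncomputable def hom [Fintype S] (T : Set S) (e f : E) : Finset S :=
  {s | s ∈ T ∧ G.d s = e ∧ G.r s = f}

section

variable [Fintype S]

theorem mem_hom {T : Set S} {e f : E} {s : S} :
    s ∈ G.hom T e f ↔ s ∈ T ∧ G.d s = e ∧ G.r s = f := by
  simp [hom]

theorem hom_mono {T T' : Set S} (h : T ⊆ T') (e f : E) : G.hom T e f ⊆ G.hom T' e f := by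
  intro s
  simp only [mem_hom]
  exact fun hs => ⟨h hs.1, hs.2⟩

theorem mul_mem_hom {T : Subsemigroup S} {e f g : E} {s t : S} (hs : s ∈ G.hom T e f)
    (ht : t ∈ G.hom T f g) : s * t ∈ G.hom T e g := by
  rw [mem_hom] at hs ht ⊢
  have h : G.r s = G.d t := hs.2.2.trans ht.2.1.symm
  exact ⟨T.mul_mem hs.1 ht.1, (G.d_mul h).trans hs.2.1, (G.r_mul h).trans ht.2.2⟩

theorem card_hom_univ_comm (e f : E) : (G.hom Set.univ e f).card = (G.hom Set.univ f e).card := by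
  refine Finset.card_nbij' G.inv G.inv ?_ ?_ (fun s _ => G.inv_inv s) (fun s _ => G.inv_inv s)
  all_goals
    intro s hs
    simp only [Finset.mem_coe, mem_hom, Set.mem_univ, true_and, G.d_inv, G.r_inv] at hs ⊢
    exact hs.symm

/-- Since `T` need not be closed under inversion, x ↦ u * x * u replaces it; groupoid cancellation
makes this map injective. -/
theorem card_hom_le_of_nonempty {T : Subsemigroup S} {e f : E} (h : (G.hom T f e).Nonempty) :
    (G.hom T e f).card ≤ (G.hom T f e).card := by
  obtain ⟨u, hu⟩ := h
  refine Finset.card_le_card_of_injOn (fun x => u * x * u)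
    (fun x hx => G.mul_mem_hom (G.mul_mem_hom hu hx) hu) ?_
  intro x hx y hy hxy
  have h1 := (G.mem_hom.1 (G.mul_mem_hom hu hx)).2.2
  have h2 := (G.mem_hom.1 (G.mul_mem_hom hu hy)).2.2
  simp only [Finset.mem_coe, mem_hom] at hu hx hy
  have h3 : u * x = u * y := G.mul_right_injective (h1.trans hu.2.1.symm)
    (h2.trans hu.2.1.symm) hxy
  exact G.mul_left_injective (hu.2.2.trans hx.2.1.symm) (hu.2.2.trans hy.2.1.symm) h3

/-- Two objects are connected in `T` if `T` has elements between them in both directions. -/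
def connected (T : Subsemigroup S) : Setoid E where
  r e f := e = f ∨ (G.hom T e f).Nonempty ∧ (G.hom T f e).Nonempty
  iseqv := by
    refine ⟨fun e => Or.inl rfl, fun h => h.imp Eq.symm And.symm, ?_⟩
    rintro e f g (rfl | ⟨⟨s, hs⟩, ⟨t, ht⟩⟩) (rfl | ⟨⟨u, hu⟩, ⟨v, hv⟩⟩)
    · exact Or.inl rfl
    · exact Or.inr ⟨⟨u, hu⟩, ⟨v, hv⟩⟩
    · exact Or.inr ⟨⟨s, hs⟩, ⟨t, ht⟩⟩
    · exact Or.inr ⟨⟨_, G.mul_mem_hom hs hu⟩, ⟨_, G.mul_mem_hom hv ht⟩⟩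

theorem connected_mono {T T' : Subsemigroup S} (h : T ≤ T') : G.connected T ≤ G.connected T' := by
  rintro e f (rfl | ⟨h1, h2⟩)
  · exact Or.inl rfl
  · exact Or.inr ⟨h1.mono (G.hom_mono h _ _), h2.mono (G.hom_mono h _ _)⟩

/-- Gaining an arrow e → f could leave the maximum unchanged only if f → e had more arrows. Under
the first alternative of `hc` that is excluded by `card_hom_le_of_nonempty`, under the second
because there are none. -/
theorem max_card_hom_lt {T T' : Subsemigroup S} (h : T ≤ T') {e f : E} {x : S}
    (hx : x ∈ G.hom T' e f) (hxT : x ∉ T)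
    (hc : (G.hom T e f).Nonempty ∧ (G.hom T f e).Nonempty ∨ ¬ (G.hom T' f e).Nonempty) :
    max (G.hom T e f).card (G.hom T f e).card < max (G.hom T' e f).card (G.hom T' f e).card := by
  have hlt : (G.hom T e f).card < (G.hom T' e f).card :=
    Finset.card_lt_card (Finset.ssubset_iff_of_subset (G.hom_mono h _ _) |>.2
      ⟨x, hx, fun hx' => hxT (G.mem_hom.1 hx').1⟩)
  refine lt_of_lt_of_le ?_ (le_max_left _ _)
  rcases hc with hc | hc
  · have h1 := G.card_hom_le_of_nonempty hc.1
    exact max_lt hlt (h1.trans_lt hlt)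
  · have h2 : G.hom T f e = ∅ := by
      rw [Finset.not_nonempty_iff_eq_empty] at hc
      exact Finset.subset_empty.1 (hc ▸ G.hom_mono h f e)
    rw [h2]
    exact max_lt hlt (by simpa using (Nat.zero_le _).trans_lt hlt)

end

section

variable [Fintype S] [Fintype E]

/-- A measure of subsemigroups that increases strictly along chains. -/
noncomputable def potential (idx : E → ℕ) (T : Subsemigroup S) : ℕ :=
  ∑ p : E × E with idx p.1 < idx p.2, max (G.hom T p.1 p.2).card (G.hom T p.2 p.1).card +
    ∑ e : E, (G.hom T e e).card + (Nat.card E - Nat.card (Quotient (G.connected T)))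

/-- A new loop raises the second sum. A new arrow between distinct objects raises the maximum for
that pair, except possibly when it first makes the pair connected in both directions; then two
connected classes merge and the last term rises. -/
theorem potential_strictMono {idx : E → ℕ} (hidx : Function.Injective idx) :
    StrictMono (G.potential idx) := by
  intro T T' hlt
  have hle : T ≤ T' := hlt.le
  obtain ⟨x, hxT', hxT⟩ := SetLike.exists_of_lt hlt
  have hx : x ∈ G.hom T' (G.d x) (G.r x) := G.mem_hom.2 ⟨hxT', rfl, rfl⟩
  have m0 : ∀ e f, (G.hom T e f).card ≤ (G.hom T' e f).card :=
    fun e f => Finset.card_le_card (G.hom_mono hle e f)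
  have m1 : ∀ p ∈ ({p | idx p.1 < idx p.2} : Finset (E × E)),
      max (G.hom T p.1 p.2).card (G.hom T p.2 p.1).card ≤
        max (G.hom T' p.1 p.2).card (G.hom T' p.2 p.1).card :=
    fun p _ => max_le_max (m0 _ _) (m0 _ _)
  have m2 : ∀ e ∈ (Finset.univ : Finset E), (G.hom T e e).card ≤ (G.hom T' e e).card :=
    fun e _ => m0 e e
  have m3 := Setoid.card_quotient_le_of_le (G.connected_mono hle)
  -- This keeps the truncated subtraction in `potential` faithful: fewer classes do mean a larger
  -- last term.
  have m4 : Nat.card (Quotient (G.connected T)) ≤ Nat.card E :=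
    Nat.card_le_card_of_surjective (Quotient.mk _) Quotient.mk_surjective
  have s1 := Finset.sum_le_sum m1
  have s2 := Finset.sum_le_sum m2
  have key : G.d x ≠ G.r x →
      max (G.hom T (G.d x) (G.r x)).card (G.hom T (G.r x) (G.d x)).card <
        max (G.hom T' (G.d x) (G.r x)).card (G.hom T' (G.r x) (G.d x)).card →
      ∑ p : E × E with idx p.1 < idx p.2, max (G.hom T p.1 p.2).card (G.hom T p.2 p.1).card <
      ∑ p : E × E with idx p.1 < idx p.2, max (G.hom T' p.1 p.2).card (G.hom T' p.2 p.1).card := by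
    intro hne h
    rcases lt_or_gt_of_ne (hidx.ne hne) with hi | hi
    · exact Finset.sum_lt_sum m1 ⟨(G.d x, G.r x), by simpa using hi, h⟩
    · refine Finset.sum_lt_sum m1 ⟨(G.r x, G.d x), by simpa using hi, ?_⟩
      rwa [max_comm, max_comm (G.hom T' _ _).card]
  unfold potential
  by_cases he : G.d x = G.r x
  · have : ∑ e : E, (G.hom T e e).card < ∑ e : E, (G.hom T' e e).card := by
      refine Finset.sum_lt_sum m2 ⟨G.d x, Finset.mem_univ _, Finset.card_lt_card ?_⟩
      refine Finset.ssubset_iff_of_subset (G.hom_mono hle _ _) |>.2 ⟨x, ?_, fun hx' => ?_⟩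
      · exact G.mem_hom.2 ⟨hxT', rfl, he.symm⟩
      · exact hxT (G.mem_hom.1 hx').1
    omega
  by_cases hc : (G.hom T (G.d x) (G.r x)).Nonempty ∧ (G.hom T (G.r x) (G.d x)).Nonempty
  · have := key he (G.max_card_hom_lt hle hx hxT (Or.inl hc))
    omega
  by_cases hc' : (G.hom T' (G.r x) (G.d x)).Nonempty
  · have h1 : Nat.card (Quotient (G.connected T')) < Nat.card (Quotient (G.connected T)) :=
      Setoid.card_quotient_lt_of_le (G.connected_mono hle) (a := G.d x) (b := G.r x)
        (Or.inr ⟨⟨x, hx⟩, hc'⟩) (not_or.2 ⟨he, hc⟩)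
    omega
  · have := key he (G.max_card_hom_lt hle hx hxT (Or.inr hc'))
    omega

theorem sum_card_hom_lt (idx : E → ℕ) :
    ∑ p : E × E with idx p.1 < idx p.2, (G.hom Set.univ p.1 p.2).card = (G.upper idx).ncard := by
  classical
  rw [Set.ncard_eq_toFinset_card', Finset.card_eq_sum_card_fiberwise
    (f := fun s => (G.d s, G.r s)) (t := ({p | idx p.1 < idx p.2} : Finset (E × E)))]
  · refine Finset.sum_congr rfl fun p hp => congrArg _ ?_
    ext s
    simp only [mem_hom, mem_upper, Set.mem_univ, true_and, Finset.mem_filter, Set.mem_toFinset, Prod.ext_iff, Finset.mem_univ] at hp ⊢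
    constructor
    · rintro ⟨h1, h2⟩
      exact ⟨by rwa [h1, h2], h1, h2⟩
    · exact fun h => h.2
  · intro s hs
    simpa [mem_upper] using hs

theorem sum_card_hom_self : ∑ e : E, (G.hom Set.univ e e).card = G.loops.ncard := by
  classical
  rw [Set.ncard_eq_toFinset_card', Finset.card_eq_sum_card_fiberwise
    (f := G.d) (t := Finset.univ) (fun s _ => Finset.mem_coe.2 (Finset.mem_univ _))]
  refine Finset.sum_congr rfl fun e _ => congrArg _ ?_
  ext s
  simp only [mem_hom, mem_loops, Set.mem_univ, true_and, Finset.mem_filter, Set.mem_toFinset]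
  constructor
  · rintro ⟨h1, h2⟩
    exact ⟨h1.trans h2.symm, h1⟩
  · rintro ⟨h1, h2⟩
    exact ⟨h2, h1.symm.trans h2⟩

theorem potential_le (idx : E → ℕ) (T : Subsemigroup S) :
    G.potential idx T ≤ (G.upper idx).ncard + G.loops.ncard + Nat.card E := by
  rw [← G.sum_card_hom_lt, ← G.sum_card_hom_self]
  have m0 : ∀ e f, (G.hom T e f).card ≤ (G.hom Set.univ e f).card :=
    fun e f => Finset.card_le_card (G.hom_mono (Set.subset_univ _) e f)
  unfold potential
  gcongr ?_ + ?_ + ?_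
  · exact Finset.sum_le_sum fun p _ => max_le (m0 _ _) ((m0 _ _).trans (G.card_hom_univ_comm _ _).le)
  · exact Finset.sum_le_sum fun e _ => m0 e e
  · exact Nat.sub_le _ _

end

/-! ### Loops control the deviation from one half -/

theorem card_objects_le_loops [Finite S] : Nat.card E ≤ G.loops.ncard := by
  choose f hf using G.exists_unit
  refine Nat.card_le_card_of_injective (β := G.loops)
    (fun e => ⟨f e, (hf e).1.trans (hf e).2.symm⟩) fun e e' h => ?_
  have h' : f e = f e' := Subtype.ext_iff.1 h
  rw [← (hf e).1, ← (hf e').1, h']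

/-- With U upward arrows and L loops, the length is at most U + L + |E| ≤ U + 2L, and 2U + 4L = |S|
+ 3L. -/
theorem two_mul_semigroupLength_le [Finite S] [Finite E] :
    2 * semigroupLength S ≤ Nat.card S + 3 * G.loops.ncard := by
  have := Fintype.ofFinite S
  have := Fintype.ofFinite E
  obtain ⟨idx, hidx⟩ : ∃ idx : E → ℕ, Function.Injective idx :=
    ⟨fun e => Finite.equivFin E e, Fin.val_injective.comp (Finite.equivFin E).injective⟩
  have h1 := semigroupLength_le_of_strictMono _ _ (G.potential_strictMono hidx)
    (G.potential_le idx)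
  have h2 := G.card_eq hidx
  have h3 := G.card_objects_le_loops
  push_cast at h1
  omega

/-- From |S| = 2U + L and U ≤ l(S) + 1; the leftover 2 is absorbed by 2L, as there is at least one
loop. -/
theorem card_le_two_mul_semigroupLength [Finite S] [Finite E] [Nonempty S] :
    (Nat.card S : ℤ) ≤ 2 * semigroupLength S + 3 * G.loops.ncard := by
  obtain ⟨idx, hidx⟩ : ∃ idx : E → ℕ, Function.Injective idx :=
    ⟨fun e => Finite.equivFin E e, Fin.val_injective.comp (Finite.equivFin E).injective⟩
  have h1 := G.card_upper_le_semigroupLength idx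
  have h2 := G.card_eq hidx
  have h3 := G.card_objects_le_loops
  have : Nonempty E := ⟨G.d (Classical.arbitrary S)⟩
  have h4 : 0 < Nat.card E := Nat.card_pos
  omega

/-- If most objects are connected to at least `m` objects, then few elements are loops. -/
theorem mul_ncard_loops_le [Finite S] (m : ℕ) (bad : Set E)
    (hm : ∀ e ∉ bad, m ≤ {f | ∃ s, G.d s = e ∧ G.r s = f}.ncard) :
    m * G.loops.ncard ≤ Nat.card S + m * {s | s ∈ G.loops ∧ G.d s ∈ bad}.ncard := by
  have h1 : G.loops = {s | s ∈ G.loops ∧ G.d s ∉ bad} ∪ {s | s ∈ G.loops ∧ G.d s ∈ bad} := by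
    ext s
    simp only [Set.mem_union, Set.mem_ofPred_eq]
    tauto
  have h2 : m * {s | s ∈ G.loops ∧ G.d s ∉ bad}.ncard ≤ Nat.card S := by
    have hf : ∀ e : {e // e ∉ bad}, ∃ f : Fin m → S, Function.Injective (fun i => G.r (f i)) ∧
        ∀ i, G.d (f i) = e := by
      intro e
      have hfin : {f | ∃ s, G.d s = e ∧ G.r s = f}.Finite := by
        refine (Set.finite_range G.r).subset ?_
        rintro f ⟨s, -, h⟩
        exact ⟨s, h⟩
      have := hfin.to_subtype
      have hcard : Nat.card (Fin m) ≤ Nat.card {f | ∃ s, G.d s = e ∧ G.r s = f} := by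
        rw [Nat.card_fin]
        exact hm e e.2
      have hne : Nonempty (Fin m ↪ {f | ∃ s, G.d s = e ∧ G.r s = f}) := by
        have := Fintype.ofFinite {f | ∃ s, G.d s = e ∧ G.r s = f}
        rw [Function.Embedding.nonempty_iff_card_le]
        simpa using hcard
      obtain ⟨g⟩ := hne
      choose f hf using fun i => (g i).2
      refine ⟨f, fun i j hij => g.injective (Subtype.ext ?_), fun i => (hf i).1⟩
      rw [← (hf i).2, ← (hf j).2]
      exact hij
    choose f hf hd using hf
    -- The pair (i, s) goes to s followed by the i-th chosen arrow out of its object. The product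
    -- reveals the object as its source, then i by its target, then s by cancellation.
    have := Nat.card_le_card_of_injective
      (fun p : Fin m × {s | s ∈ G.loops ∧ G.d s ∉ bad} => p.2.1 * f ⟨_, p.2.2.2⟩ p.1) (by
        rintro ⟨i, s, hs, hs'⟩ ⟨j, t, ht, ht'⟩ h
        simp only at h
        have cs : G.r s = G.d (f ⟨_, hs'⟩ i) := (hd ⟨_, hs'⟩ i).symm ▸ hs.symm
        have ct : G.r t = G.d (f ⟨_, ht'⟩ j) := (hd ⟨_, ht'⟩ j).symm ▸ ht.symm
        have e1 : G.d s = G.d t := by rw [← G.d_mul cs, h, G.d_mul ct]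
        have e2 : (⟨_, hs'⟩ : {e // e ∉ bad}) = ⟨_, ht'⟩ := Subtype.ext e1
        have e3 : i = j := by
          apply hf ⟨_, ht'⟩
          simp only
          rw [← G.r_mul ct, ← h, G.r_mul cs, e2]
        subst e3
        rw [← e2] at h ct
        have := G.mul_right_injective cs ct h
        subst this
        rfl)
    rwa [Nat.card_prod, Nat.card_fin] at this
  conv_lhs => rw [h1]
  calc _ ≤ m * ({s | s ∈ G.loops ∧ G.d s ∉ bad}.ncard + {s | s ∈ G.loops ∧ G.d s ∈ bad}.ncard) :=
        Nat.mul_le_mul_left _ (Set.ncard_union_le _ _)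
    _ ≤ _ := by rw [mul_add]; omega

end GroupoidGrading

/-- If the proportion of loops tends to zero, then the length is asymptotically half of the
order. -/
theorem tendsto_semigroupLength_div_card {S E : ℕ → Type*} [∀ n, Mul (S n)] [∀ n, Finite (S n)]
    [∀ n, Finite (E n)] [∀ n, Nonempty (S n)] (G : ∀ n, GroupoidGrading (S n) (E n)) (C : ℕ)
    (h : ∀ n, n * (G (n + 3)).loops.ncard ≤ C * Nat.card (S (n + 3))) :
    Tendsto (fun n => (semigroupLength (S n) : ℝ) / (Nat.card (S n) : ℝ)) atTop (𝓝 (1 / 2)) := by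
  -- One more than the shift 3 in `h`, so that the divisor n + 1 is never zero.
  rw [← tendsto_add_atTop_iff_nat 4]
  -- The two bounds give |2l - |S|| ≤ 3L, so the deviation is at most (3/2)·L/|S|; the constant 2C
  -- leaves room.
  have key : ∀ n : ℕ, |(semigroupLength (S (n + 4)) : ℝ) / (Nat.card (S (n + 4)) : ℝ) - 1 / 2| ≤
      2 * C * (1 / ((n : ℝ) + 1)) := by
    intro n
    have h1 : (2 : ℝ) * semigroupLength (S (n + 4)) ≤
        Nat.card (S (n + 4)) + 3 * (G (n + 4)).loops.ncard := by
      exact_mod_cast (G (n + 4)).two_mul_semigroupLength_le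
    have h2 : (Nat.card (S (n + 4)) : ℝ) ≤
        2 * semigroupLength (S (n + 4)) + 3 * (G (n + 4)).loops.ncard := by
      exact_mod_cast (G (n + 4)).card_le_two_mul_semigroupLength
    have h3 : ((n : ℝ) + 1) * (G (n + 4)).loops.ncard ≤ C * Nat.card (S (n + 4)) := by
      exact_mod_cast h (n + 1)
    have hpos : (0 : ℝ) < Nat.card (S (n + 4)) := by exact_mod_cast Nat.card_pos
    have hn : (0 : ℝ) < (n : ℝ) + 1 := by positivity
    have h4 : ((G (n + 4)).loops.ncard : ℝ) ≤ C * Nat.card (S (n + 4)) * (1 / ((n : ℝ) + 1)) := by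
      rw [mul_one_div, le_div_iff₀ hn]
      linarith
    have h5 : (semigroupLength (S (n + 4)) : ℝ) / (Nat.card (S (n + 4)) : ℝ) - 1 / 2 =
        (2 * semigroupLength (S (n + 4)) - Nat.card (S (n + 4))) / (2 * Nat.card (S (n + 4))) := by
      field_simp
    have h6 : (0 : ℝ) ≤ C * Nat.card (S (n + 4)) * (1 / ((n : ℝ) + 1)) := by positivity
    rw [h5, abs_div, abs_of_pos (by positivity : (0 : ℝ) < 2 * Nat.card (S (n + 4))),
      div_le_iff₀ (by positivity), abs_le]
    constructor <;> linarith
  rw [tendsto_iff_norm_sub_tendsto_zero]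
  refine squeeze_zero (fun _ => norm_nonneg _) key ?_
  simpa using (tendsto_one_div_add_atTop_nhds_zero_nat (𝕜 := ℝ)).const_mul (2 * (C : ℝ))

/-- The grading inherited by a subsemigroup that is closed under inverses and contains all
units. -/
noncomputable def GroupoidGrading.comap {S S' E : Type*} [Mul S] [Mul S'] (G : GroupoidGrading S E)
    (φ : S' →ₙ* S) (hφ : Function.Injective φ) (hinv : ∀ s, ∃ t, φ t = G.inv (φ s))
    (hunit : ∀ e, ∃ s, G.d (φ s) = e ∧ G.r (φ s) = e) : GroupoidGrading S' E where
  d s := G.d (φ s)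
  r s := G.r (φ s)
  inv s := (hinv s).choose
  rank s := G.rank (φ s)
  d_mul h := by rw [map_mul, G.d_mul h]
  r_mul h := by rw [map_mul, G.r_mul h]
  d_inv s := by rw [(hinv s).choose_spec, G.d_inv]
  r_inv s := by rw [(hinv s).choose_spec, G.r_inv]
  inv_inv s := hφ (by rw [(hinv _).choose_spec, (hinv s).choose_spec, G.inv_inv])
  inv_mul_cancel {s _} h := hφ (by
    rw [map_mul, map_mul, (hinv s).choose_spec, G.inv_mul_cancel h])
  mul_inv_cancel {s _} h := hφ (by
    rw [map_mul, map_mul, (hinv s).choose_spec, G.mul_inv_cancel h])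
  rank_mul_left s t := by rw [map_mul]; exact G.rank_mul_left _ _
  rank_mul_right s t := by rw [map_mul]; exact G.rank_mul_right _ _
  composable {s t} h1 h2 := by rw [map_mul] at h1 h2; exact G.composable h1 h2
  exists_unit := hunit

/-- Induction through Pascal's rule. It supplies enough objects of each intermediate rank. -/
theorem Nat.le_choose_of_pos_of_lt : ∀ {n k : ℕ}, 0 < k → k < n → n ≤ n.choose k
  | n + 1, k + 1, _, h => by
    rw [Nat.choose_succ_succ]
    rcases Nat.eq_zero_or_pos k with rfl | hk
    · simp [add_comm]
    rcases Nat.lt_or_ge (k + 1) n with h' | h'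
    · have h1 := Nat.le_choose_of_pos_of_lt (Nat.succ_pos k) h'
      have h2 := Nat.choose_pos (n := n) (k := k) (by omega)
      omega
    · have : n = k + 1 := by omega
      subst this
      simp

/-! ### The symmetric inverse monoid and its submonoids: grading and counting -/

namespace SymInvMonoid

variable {n : ℕ}

/-- The inverse of a partial injection. -/
def symm (f : SymInvMonoid n) : SymInvMonoid n := PEquiv.symm f

theorem symm_app {f : SymInvMonoid n} {a b : Fin n} :
    f.symm.app b = some a ↔ f.app a = some b := PEquiv.eq_some_iff (f : Fin n ≃. Fin n)

theorem ext_app {f g : SymInvMonoid n} (h : ∀ a b, f.app a = some b ↔ g.app a = some b) :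
    f = g :=
  PEquiv.ext fun a => Option.ext fun b => h a b

theorem mul_app_eq_some {f g : SymInvMonoid n} {a c : Fin n} :
    (f * g).app a = some c ↔ ∃ b, f.app a = some b ∧ g.app b = some c := by
  rw [mul_app, Option.bind_eq_some_iff]

/-- The domain of a partial injection. -/
def dom (f : SymInvMonoid n) : Finset (Fin n) := {a | (f.app a).isSome}

/-- The image of a partial injection. -/
def ran (f : SymInvMonoid n) : Finset (Fin n) := f.symm.dom

theorem mem_dom {f : SymInvMonoid n} {a : Fin n} : a ∈ f.dom ↔ ∃ b, f.app a = some b := by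
  simp [dom, Option.isSome_iff_exists]

theorem mem_ran {f : SymInvMonoid n} {b : Fin n} : b ∈ f.ran ↔ ∃ a, f.app a = some b := by
  simp [ran, mem_dom, symm_app]

theorem card_dom_le_card_ran (f : SymInvMonoid n) : f.dom.card ≤ f.ran.card := by
  have h : ∀ a ∈ f.dom, ∃ b, f.app a = some b := fun a ha => mem_dom.1 ha
  choose g hg using h
  refine Finset.card_le_card_of_injOn (fun a => if h : a ∈ f.dom then g a h else a) ?_ ?_
  · intro a ha
    rw [Finset.mem_coe] at ha
    simp only [ha, dite_true]
    exact mem_ran.2 ⟨a, hg a ha⟩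
  · intro a ha b hb hab
    rw [Finset.mem_coe] at ha hb
    simp only [ha, hb, dite_true] at hab
    exact f.app_inj (hg a ha) (hab ▸ hg b hb)

theorem card_ran (f : SymInvMonoid n) : f.ran.card = f.dom.card :=
  le_antisymm (f.symm.card_dom_le_card_ran) f.card_dom_le_card_ran

theorem dom_mul_subset (f g : SymInvMonoid n) : (f * g).dom ⊆ f.dom := by
  intro a ha
  obtain ⟨c, hc⟩ := mem_dom.1 ha
  obtain ⟨b, hb, -⟩ := mul_app_eq_some.1 hc
  exact mem_dom.2 ⟨b, hb⟩

theorem ran_mul_subset (f g : SymInvMonoid n) : (f * g).ran ⊆ g.ran := by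
  intro c hc
  obtain ⟨a, ha⟩ := mem_ran.1 hc
  obtain ⟨b, -, hb⟩ := mul_app_eq_some.1 ha
  exact mem_ran.2 ⟨b, hb⟩

theorem dom_mul {f g : SymInvMonoid n} (h : f.ran = g.dom) : (f * g).dom = f.dom := by
  refine (dom_mul_subset f g).antisymm fun a ha => ?_
  obtain ⟨b, hb⟩ := mem_dom.1 ha
  obtain ⟨c, hc⟩ := mem_dom.1 (h ▸ mem_ran.2 ⟨a, hb⟩ : b ∈ g.dom)
  exact mem_dom.2 ⟨c, mul_app_eq_some.2 ⟨b, hb, hc⟩⟩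

theorem ran_mul {f g : SymInvMonoid n} (h : f.ran = g.dom) : (f * g).ran = g.ran := by
  refine (ran_mul_subset f g).antisymm fun c hc => ?_
  obtain ⟨b, hb⟩ := mem_ran.1 hc
  obtain ⟨a, ha⟩ := mem_ran.1 (h ▸ mem_dom.2 ⟨c, hb⟩ : b ∈ f.ran)
  exact mem_ran.2 ⟨a, mul_app_eq_some.2 ⟨b, ha, hb⟩⟩

/-- The identity map of `A`. -/
def idOn (A : Finset (Fin n)) : SymInvMonoid n := PEquiv.ofSet (A : Set (Fin n))

theorem idOn_app {A : Finset (Fin n)} {a b : Fin n} :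
    (idOn A).app a = some b ↔ a = b ∧ a ∈ A := by
  have := PEquiv.mem_ofSet_iff (s := (A : Set (Fin n))) (a := b) (b := a)
  exact this.trans ⟨fun h => h.1 ▸ ⟨rfl, h.2⟩, fun h => h.1 ▸ ⟨rfl, h.2⟩⟩

theorem idOn_dom (A : Finset (Fin n)) : (idOn A).dom = A := by
  ext a
  simp [mem_dom, idOn_app]

theorem idOn_ran (A : Finset (Fin n)) : (idOn A).ran = A := by
  ext a
  simp [mem_ran, idOn_app]

theorem idOn_mem_POI (A : Finset (Fin n)) : idOn A ∈ POI n := by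
  intro a b a' b' ha hb hab
  rw [idOn_app] at ha hb
  rwa [← ha.1, ← hb.1]

/-- The symmetric inverse monoid as a graded groupoid. -/
def grading (n : ℕ) : GroupoidGrading (SymInvMonoid n) (Finset (Fin n)) where
  d := dom
  r := ran
  inv := symm
  rank f := f.dom.card
  d_mul := dom_mul
  r_mul := ran_mul
  d_inv _ := rfl
  r_inv _ := rfl
  inv_inv _ := rfl
  inv_mul_cancel {s t} h := by
    refine ext_app fun a c => ?_
    simp only [mul_app_eq_some, symm_app]
    constructor
    · rintro ⟨x, hx, y, hy, hc⟩
      rw [hx, Option.some_inj] at hy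
      exact hy ▸ hc
    · intro hc
      obtain ⟨x, hx⟩ := mem_ran.1 (h ▸ mem_dom.2 ⟨c, hc⟩ : a ∈ s.ran)
      exact ⟨x, hx, a, hx, hc⟩
  mul_inv_cancel {s t} h := by
    refine ext_app fun a c => ?_
    simp only [mul_app_eq_some, symm_app]
    constructor
    · rintro ⟨x, ⟨y, hy, hx⟩, hc⟩
      rwa [s.app_inj hc hx]
    · intro hc
      obtain ⟨x, hx⟩ := mem_dom.1 (h ▸ mem_ran.2 ⟨a, hc⟩ : c ∈ s.dom)
      exact ⟨x, ⟨c, hc, hx⟩, hx⟩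
  rank_mul_left s t := Finset.card_le_card (dom_mul_subset s t)
  rank_mul_right s t := by
    rw [← card_ran, ← card_ran]
    exact Finset.card_le_card (ran_mul_subset s t)
  composable {s t} h1 h2 := by
    rw [← card_ran, ← card_ran t] at h2
    -- Equal ranks force the product to keep the whole domain of `s` and the whole image of `t`, so
    -- neither `s.ran` nor `t.dom` has a point outside the other.
    have e1 := Finset.eq_of_subset_of_card_le (dom_mul_subset s t) h1.ge
    have e2 := Finset.eq_of_subset_of_card_le (ran_mul_subset s t) h2.ge
    ext b
    constructor
    · intro hb
      obtain ⟨a, ha⟩ := mem_ran.1 hb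
      obtain ⟨c, hc⟩ := mem_dom.1 (e1 ▸ mem_dom.2 ⟨b, ha⟩ : a ∈ (s * t).dom)
      obtain ⟨b', hb', hc'⟩ := mul_app_eq_some.1 hc
      rw [ha, Option.some_inj] at hb'
      exact mem_dom.2 ⟨c, hb' ▸ hc'⟩
    · intro hb
      obtain ⟨c, hc⟩ := mem_dom.1 hb
      obtain ⟨a, ha⟩ := mem_ran.1 (e2 ▸ mem_ran.2 ⟨b, hc⟩ : c ∈ (s * t).ran)
      obtain ⟨b', hb', hc'⟩ := mul_app_eq_some.1 ha
      rw [t.app_inj hc hc']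
      exact mem_ran.2 ⟨a, hb'⟩
  exists_unit A := ⟨idOn A, idOn_dom A, idOn_ran A⟩

/-! ### Counting loops among partial injections -/

theorem symm_mem_POI {f : SymInvMonoid n} (hf : f ∈ POI n) : f.symm ∈ POI n := by
  intro a b a' b' ha hb hab
  rw [symm_app] at ha hb
  rcases lt_trichotomy a' b' with h | rfl | h
  · exact h
  · rw [ha, Option.some_inj] at hb
    exact absurd hb hab.ne
  · exact absurd (hf _ _ _ _ hb ha h) hab.asymm

/-- The order isomorphism between sets of equal size. Hence all objects of one rank are connected as
soon as the semigroup contains `POI n`. -/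
theorem exists_mem_POI {A B : Finset (Fin n)} (h : A.card = B.card) :
    ∃ f ∈ POI n, f.dom = A ∧ f.ran = B := by
  classical
  let e : A ≃o B := (A.orderIsoOfFin h).symm.trans (B.orderIsoOfFin rfl)
  let f : SymInvMonoid n :=
    { toFun := fun a => if h : a ∈ A then some (e ⟨a, h⟩) else none
      invFun := fun b => if h : b ∈ B then some (e.symm ⟨b, h⟩) else none
      inv := by
        intro a b
        simp only [Option.dite_none_right_eq_some, Option.some_inj]
        constructor
        · rintro ⟨hb, rfl⟩
          simp
        · rintro ⟨ha, rfl⟩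
          simp }
  have hf : ∀ a b, f.app a = some b ↔ ∃ h : a ∈ A, (e ⟨a, h⟩ : Fin n) = b := by
    intro a b
    change (if h : a ∈ A then some (e ⟨a, h⟩ : Fin n) else none) = some b ↔ _
    rw [Option.dite_none_right_eq_some]
    simp only [Option.some_inj]
  refine ⟨f, ?_, ?_, ?_⟩
  · intro a b a' b' ha hb hab
    obtain ⟨h1, rfl⟩ := (hf _ _).1 ha
    obtain ⟨h2, rfl⟩ := (hf _ _).1 hb
    exact e.strictMono hab
  · ext a
    simp [mem_dom, hf]
  · ext b
    rw [mem_ran]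
    constructor
    · rintro ⟨a, ha⟩
      obtain ⟨h1, rfl⟩ := (hf _ _).1 ha
      exact (e _).2
    · intro hb
      exact ⟨e.symm ⟨b, hb⟩, (hf _ _).2 ⟨(e.symm ⟨b, hb⟩).2, by simp⟩⟩

theorem eq_of_dom_eq_empty {f g : SymInvMonoid n} (hf : f.dom = ∅) (hg : g.dom = ∅) : f = g := by
  refine ext_app fun a b => ⟨fun h => ?_, fun h => ?_⟩
  · exact absurd (hf ▸ mem_dom.2 ⟨b, h⟩ : a ∈ (∅ : Finset (Fin n))) (Finset.notMem_empty a)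
  · exact absurd (hg ▸ mem_dom.2 ⟨b, h⟩ : a ∈ (∅ : Finset (Fin n))) (Finset.notMem_empty a)

theorem dom_idOn_mul {i : Fin n} {f : SymInvMonoid n} (hf : f.dom = Finset.univ) :
    (idOn {i}ᶜ * f).dom = {i}ᶜ := by
  refine Finset.Subset.antisymm (by simpa only [idOn_dom] using dom_mul_subset (idOn {i}ᶜ) f) ?_
  intro a ha
  obtain ⟨b, hb⟩ := mem_dom.1 (hf ▸ Finset.mem_univ a : a ∈ f.dom)
  exact mem_dom.2 ⟨b, mul_app_eq_some.2 ⟨a, idOn_app.2 ⟨rfl, ha⟩, hb⟩⟩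

/-- A permutation is determined by its restriction to the complement of a point. -/
theorem eq_of_idOn_mul_eq {i : Fin n} {f g : SymInvMonoid n} (hf : f.dom = Finset.univ)
    (hf' : f.ran = Finset.univ) (hg : g.dom = Finset.univ)
    (h : idOn {i}ᶜ * f = idOn {i}ᶜ * g) : f = g := by
  have key : ∀ a b, a ≠ i → (f.app a = some b ↔ g.app a = some b) := by
    intro a b ha
    have := congrArg (fun k => k.app a = some b) h
    simpa [mul_app_eq_some, idOn_app, ha] using this
  obtain ⟨x, hx⟩ := mem_dom.1 (hf ▸ Finset.mem_univ i : i ∈ f.dom)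
  obtain ⟨y, hy⟩ := mem_dom.1 (hg ▸ Finset.mem_univ i : i ∈ g.dom)
  -- The value at `i` is forced: `y` is attained by `f` somewhere, and attaining it at c ≠ i would
  -- give g two preimages of `y`.
  have hxy : x = y := by
    obtain ⟨c, hc⟩ := mem_ran.1 (hf' ▸ Finset.mem_univ y : y ∈ f.ran)
    by_cases hci : c = i
    · subst hci
      rw [hx, Option.some_inj] at hc
      exact hc
    · exact absurd (g.app_inj ((key c y hci).1 hc) hy) hci
  refine ext_app fun a b => ?_
  by_cases ha : a = i
  · subst ha
    rw [hx, hy, hxy]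
  · exact key a b ha

variable {S : Type*} [Mul S] (φ : S →ₙ* SymInvMonoid n) (hφ : Function.Injective φ)
  (hinv : ∀ s, ∃ t, φ t = (φ s).symm) (hPOI : ∀ f ∈ POI n, ∃ s, φ s = f)

/-- The grading of a subsemigroup of the symmetric inverse monoid that is closed under inverses
and contains all order-preserving partial injections. -/
noncomputable def subGrading : GroupoidGrading S (Finset (Fin n)) :=
  (grading n).comap φ hφ hinv fun A => by
    obtain ⟨s, hs⟩ := hPOI _ (idOn_mem_POI A)
    exact ⟨s, by rw [hs]; exact ⟨idOn_dom A, idOn_ran A⟩⟩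

/-- Only ∅ and the full set are exceptional. The 3 counts |S| once for the other objects, once for
the empty map (as n ≤ |S|), and once for the permutations, which restrict injectively to complements
of points. -/
theorem mul_ncard_loops_subGrading_le [Finite S] :
    n * (subGrading φ hφ hinv hPOI).loops.ncard ≤ 3 * Nat.card S := by
  have h0 := (subGrading φ hφ hinv hPOI).mul_ncard_loops_le n {∅, Finset.univ} (by
    intro A hA
    simp only [Set.mem_insert_iff, Set.mem_singleton_iff, not_or] at hA
    have h1 : n ≤ n.choose A.card := by
      apply Nat.le_choose_of_pos_of_lt
      · exact Finset.card_pos.2 (Finset.nonempty_iff_ne_empty.2 hA.1)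
      · simpa using (Finset.card_lt_iff_ne_univ A).2 hA.2
    refine h1.trans ?_
    have h2 := Finset.card_powersetCard A.card (Finset.univ : Finset (Fin n))
    rw [Finset.card_fin] at h2
    rw [← h2, ← Set.ncard_coe_finset]
    refine Set.ncard_le_ncard ?_ (Set.toFinite _)
    intro B hB
    rw [Finset.mem_coe, Finset.mem_powersetCard_univ] at hB
    obtain ⟨f, hf, hf1, hf2⟩ := exists_mem_POI hB.symm
    obtain ⟨s, rfl⟩ := hPOI f hf
    exact ⟨s, hf1, hf2⟩)
  have h1 : {s | s ∈ (subGrading φ hφ hinv hPOI).loops ∧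
      (subGrading φ hφ hinv hPOI).d s ∈ ({∅, Finset.univ} : Set (Finset (Fin n)))} ⊆
      {s | (φ s).dom = ∅} ∪ {s | (φ s).dom = Finset.univ ∧ (φ s).ran = Finset.univ} := by
    rintro s ⟨hs, hs' | hs'⟩
    · exact Or.inl hs'
    · exact Or.inr ⟨hs', (Eq.symm hs).trans hs'⟩
  have h2 : {s | (φ s).dom = ∅}.ncard ≤ 1 := by
    rw [Set.ncard_le_one (Set.toFinite _)]
    exact fun s hs t ht => hφ (eq_of_dom_eq_empty hs ht)
  choose p hp using fun A => hPOI _ (idOn_mem_POI A)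
  have h3 : n ≤ Nat.card S := by
    have := Nat.card_le_card_of_injective (fun i : Fin n => p {i}) (by
      intro i j h
      have := congrArg (fun s => (φ s).dom) h
      simpa [hp, idOn_dom] using this)
    rwa [Nat.card_fin] at this
  have h4 : n * {s | (φ s).dom = Finset.univ ∧ (φ s).ran = Finset.univ}.ncard ≤ Nat.card S := by
    have := Nat.card_le_card_of_injective
      (fun q : Fin n × {s | (φ s).dom = Finset.univ ∧ (φ s).ran = Finset.univ} =>
        p {q.1}ᶜ * q.2) (by
      rintro ⟨i, s, hs, hs'⟩ ⟨j, t, ht, ht'⟩ h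
      have h' : idOn {i}ᶜ * φ s = idOn {j}ᶜ * φ t := by
        have := congrArg φ h
        simpa [hp] using this
      have hij : i = j := by
        have := congrArg dom h'
        rwa [dom_idOn_mul hs, dom_idOn_mul ht, compl_inj_iff, Finset.singleton_inj] at this
      subst hij
      have := hφ (eq_of_idOn_mul_eq hs hs' ht h')
      subst this
      rfl)
    rwa [Nat.card_prod, Nat.card_fin] at this
  have h5 := (Set.ncard_le_ncard h1 (Set.toFinite _)).trans (Set.ncard_union_le _ _)
  have h6 := Nat.mul_le_mul_left n (h5.trans (Nat.add_le_add_right h2 _))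
  rw [mul_add] at h6
  omega

end SymInvMonoid

/-! ### The three families of partial injections -/

theorem POI_le_POPI (n : ℕ) : POI n ≤ POPI n := by
  intro f hf
  refine (SymInvMonoid.isOrientationPreserving_iff _).2 ?_
  intro a b c a' b' c' ha hb hc h
  have h1 := hf _ _ _ _ ha hb
  have h2 := hf _ _ _ _ hb hc
  have h3 := hf _ _ _ _ hc ha
  unfold CyclicTriple at *
  tauto

theorem symm_mem_POPI {n : ℕ} {f : SymInvMonoid n} (hf : f ∈ POPI n) : f.symm ∈ POPI n := by
  refine (SymInvMonoid.isOrientationPreserving_iff _).2 ?_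
  intro a b c a' b' c' ha hb hc h
  rw [SymInvMonoid.symm_app] at ha hb hc
  have key := (SymInvMonoid.isOrientationPreserving_iff _).1 hf
  -- Three distinct points lie in one cyclic order or in the opposite one; the opposite order of the
  -- preimages would be carried by `f` to the opposite order of `a, b, c`.
  have h1 := key _ _ _ _ _ _ ha hc hb
  have hab : a' ≠ b' := by
    rintro rfl
    rw [ha, Option.some_inj] at hb
    unfold CyclicTriple at h
    omega
  have hbc : b' ≠ c' := by
    rintro rfl
    rw [hb, Option.some_inj] at hc
    unfold CyclicTriple at h
    omega
  have hca : c' ≠ a' := by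
    rintro rfl
    rw [hc, Option.some_inj] at ha
    unfold CyclicTriple at h
    omega
  unfold CyclicTriple at *
  omega

/-- Stated for embeddings rather than submonoids, so that the full monoid, `POI` and `POPI` are all
instances. -/
theorem tendsto_semigroupLength_of_POI_subset {S : ℕ → Type*} [∀ n, Mul (S n)]
    [∀ n, Finite (S n)] (φ : ∀ n, S n →ₙ* SymInvMonoid n) (hφ : ∀ n, Function.Injective (φ n))
    (hinv : ∀ n s, ∃ t, φ n t = (φ n s).symm) (hPOI : ∀ n, ∀ f ∈ POI n, ∃ s, φ n s = f) :
    Tendsto (fun n => (semigroupLength (S n) : ℝ) / (Nat.card (S n) : ℝ)) atTop (𝓝 (1 / 2)) := by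
  have : ∀ n, Nonempty (S n) := fun n => ⟨(hPOI n 1 (POI n).one_mem).choose⟩
  refine tendsto_semigroupLength_div_card
    (fun n => SymInvMonoid.subGrading (φ n) (hφ n) (hinv n) (hPOI n)) 3 fun n => ?_
  refine le_trans (Nat.mul_le_mul_right _ (Nat.le_add_right n 3)) ?_
  exact SymInvMonoid.mul_ncard_loops_subGrading_le _ _ _ _

theorem tendsto_semigroupLength_submonoid (M : ∀ n, Submonoid (SymInvMonoid n))
    (hinv : ∀ n, ∀ f ∈ M n, f.symm ∈ M n) (hPOI : ∀ n, POI n ≤ M n) :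
    Tendsto (fun n => (semigroupLength (M n) : ℝ) / (Nat.card (M n) : ℝ)) atTop (𝓝 (1 / 2)) :=
  tendsto_semigroupLength_of_POI_subset (fun n => ((M n).subtype : M n →ₙ* SymInvMonoid n))
    (fun _ => Subtype.val_injective) (fun n s => ⟨⟨_, hinv n _ s.2⟩, rfl⟩)
    (fun n f hf => ⟨⟨f, hPOI n hf⟩, rfl⟩)

theorem tendsto_semigroupLength_symInvMonoid :
    Tendsto (fun n : ℕ => (semigroupLength (SymInvMonoid n) : ℝ) / (Nat.card (SymInvMonoid n) : ℝ))
      atTop (𝓝 (1 / 2)) :=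
  tendsto_semigroupLength_of_POI_subset (fun _ => MulHom.id _)
    (fun _ => Function.injective_id) (fun _ s => ⟨s.symm, rfl⟩) (fun _ f _ => ⟨f, rfl⟩)

/-! ### The dual symmetric inverse monoid: grading and counting -/

namespace DualSymInvMonoid

variable {n : ℕ}

theorem mul_rel_of_rel {α β : DualSymInvMonoid n} {x y z : Fin n} (h : α.rel x y)
    (k : β.rel y z) : (α * β).rel x z := comp_of_rel h k

/-- The join in the middle is then `α.cod` itself, so the product is plain composition of relations.
This removes joins from the groupoid computations. -/
theorem mul_rel_iff_of_le {α β : DualSymInvMonoid n} (h : β.dom ≤ α.cod) {x z : Fin n} :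
    (α * β).rel x z ↔ ∃ y, α.rel x y ∧ β.rel y z := by
  constructor
  · rintro ⟨y, y', h1, h2, h3⟩
    rw [sup_eq_left.2 h] at h2
    obtain ⟨a, h4, h5⟩ := h2
    exact ⟨y', α.difunctional h1 h4 h5, h3⟩
  · rintro ⟨y, h1, h2⟩
    exact mul_rel_of_rel h1 h2

/-- The inverse of a block bijection. -/
def symm (α : DualSymInvMonoid n) : DualSymInvMonoid n where
  rel x y := α.rel y x
  left_total := α.right_total
  right_total := α.left_total
  difunctional h k m := α.difunctional m k h

theorem dom_le_dom_mul (α β : DualSymInvMonoid n) : α.dom ≤ (α * β).dom := by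
  rintro x x' ⟨y, h, h'⟩
  obtain ⟨z, hz⟩ := β.left_total y
  exact ⟨z, mul_rel_of_rel h hz, mul_rel_of_rel h' hz⟩

theorem cod_le_cod_mul (α β : DualSymInvMonoid n) : β.cod ≤ (α * β).cod := by
  rintro z z' ⟨y, h, h'⟩
  obtain ⟨x, hx⟩ := α.right_total y
  exact ⟨x, mul_rel_of_rel hx h, mul_rel_of_rel hx h'⟩

theorem dom_mul {α β : DualSymInvMonoid n} (h : α.cod = β.dom) : (α * β).dom = α.dom := by
  refine le_antisymm ?_ (dom_le_dom_mul α β)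
  rintro x x' ⟨z, h1, h2⟩
  rw [mul_rel_iff_of_le h.ge] at h1 h2
  obtain ⟨y, h1, h1'⟩ := h1
  obtain ⟨y', h2, h2'⟩ := h2
  have hy : α.cod y y' := h ▸ (⟨z, h1', h2'⟩ : β.dom y y')
  obtain ⟨w, hw, hw'⟩ := hy
  exact ⟨y, h1, α.difunctional h2 hw' hw⟩

theorem cod_mul {α β : DualSymInvMonoid n} (h : α.cod = β.dom) : (α * β).cod = β.cod := by
  refine le_antisymm ?_ (cod_le_cod_mul α β)
  rintro z z' ⟨x, h1, h2⟩
  rw [mul_rel_iff_of_le h.ge] at h1 h2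
  obtain ⟨y, h1, h1'⟩ := h1
  obtain ⟨y', h2, h2'⟩ := h2
  have hy : β.dom y y' := h ▸ (⟨x, h1, h2⟩ : α.cod y y')
  obtain ⟨w, hw, hw'⟩ := hy
  exact ⟨y, h1', β.difunctional hw hw' h2'⟩

theorem card_quotient_cod_le (α : DualSymInvMonoid n) :
    Nat.card (Quotient α.cod) ≤ Nat.card (Quotient α.dom) := by
  choose f hf using α.left_total
  refine Nat.card_le_card_of_surjective (Quotient.map' (s₁ := α.dom) (s₂ := α.cod) f ?_) ?_
  · rintro x x' ⟨y, h, h'⟩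
    exact ⟨x, hf x, α.difunctional h h' (hf x')⟩
  · refine Quotient.ind fun y => ?_
    obtain ⟨x, hx⟩ := α.right_total y
    exact ⟨Quotient.mk _ x, Quotient.sound ⟨x, hf x, hx⟩⟩

theorem card_quotient_cod (α : DualSymInvMonoid n) :
    Nat.card (Quotient α.cod) = Nat.card (Quotient α.dom) :=
  le_antisymm α.card_quotient_cod_le α.symm.card_quotient_cod_le

/-- The idempotent block bijection of an equivalence. -/
def ofSetoid (e : Setoid (Fin n)) : DualSymInvMonoid n where
  rel := e
  left_total x := ⟨x, e.refl x⟩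
  right_total x := ⟨x, e.refl x⟩
  difunctional h k m := e.trans (e.trans h (e.symm k)) m

theorem ofSetoid_dom (e : Setoid (Fin n)) : (ofSetoid e).dom = e := by
  ext x x'
  exact ⟨fun ⟨_, h, h'⟩ => e.trans h (e.symm h'), fun h => ⟨x', h, e.refl x'⟩⟩

theorem ofSetoid_cod (e : Setoid (Fin n)) : (ofSetoid e).cod = e := by
  ext x x'
  exact ⟨fun ⟨_, h, h'⟩ => e.trans (e.symm h) h', fun h => ⟨x, e.refl x, h⟩⟩

theorem finite_setoid (n : ℕ) : Finite (Setoid (Fin n)) :=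
  Finite.of_surjective dom fun e => ⟨ofSetoid e, ofSetoid_dom e⟩

/-- The dual symmetric inverse monoid as a graded groupoid. -/
noncomputable def grading (n : ℕ) : GroupoidGrading (DualSymInvMonoid n) (Setoid (Fin n)) where
  d := dom
  r := cod
  inv := symm
  rank α := Nat.card (Quotient α.dom)
  d_mul := dom_mul
  r_mul := cod_mul
  d_inv _ := rfl
  r_inv _ := rfl
  inv_inv _ := rfl
  inv_mul_cancel {s t} h := by
    refine ext_iff' fun x z => ?_
    rw [mul_rel_iff_of_le (dom_mul h).le]
    simp only [mul_rel_iff_of_le h.ge]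
    constructor
    · rintro ⟨y, hy, w, hw, hz⟩
      have hxw : t.dom x w := h ▸ (⟨y, hy, hw⟩ : s.cod x w)
      obtain ⟨v, hv, hv'⟩ := hxw
      exact t.difunctional hv hv' hz
    · intro hz
      obtain ⟨y, hy⟩ := s.right_total x
      exact ⟨y, hy, x, hy, hz⟩
  mul_inv_cancel {s t} h := by
    refine ext_iff' fun x z => ?_
    rw [mul_rel_iff_of_le (cod_mul h).ge]
    simp only [mul_rel_iff_of_le h.ge]
    constructor
    · rintro ⟨y, ⟨w, hw, hy⟩, hz⟩
      have hwz : t.cod w z := h ▸ (⟨y, hy, hz⟩ : s.dom w z)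
      obtain ⟨v, hv, hv'⟩ := hwz
      exact t.difunctional hw hv hv'
    · intro hz
      obtain ⟨y, hy⟩ := s.left_total z
      exact ⟨y, ⟨z, hz, hy⟩, hy⟩
  rank_mul_left s t := Setoid.card_quotient_le_of_le (dom_le_dom_mul s t)
  rank_mul_right s t := by
    rw [← card_quotient_cod, ← card_quotient_cod]
    exact Setoid.card_quotient_le_of_le (cod_le_cod_mul s t)
  composable {s t} h1 h2 := by
    rw [← card_quotient_cod, ← card_quotient_cod t] at h2
    -- Equal ranks mean that the product merges no further classes on either side, so classes of
    -- `s.cod` and `t.dom` cannot glue one another.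
    have e1 := Setoid.eq_of_le_of_card_quotient_eq (dom_le_dom_mul s t) h1
    have e2 := Setoid.eq_of_le_of_card_quotient_eq (cod_le_cod_mul s t) h2
    refine le_antisymm ?_ ?_
    · rintro y y' ⟨x, hx, hx'⟩
      obtain ⟨z, hz⟩ := t.left_total y
      obtain ⟨z', hz'⟩ := t.left_total y'
      have h : t.cod z z' :=
        e2 ▸ (⟨x, mul_rel_of_rel hx hz, mul_rel_of_rel hx' hz'⟩ : (s * t).cod z z')
      obtain ⟨w, hw, hw'⟩ := h
      exact ⟨z', t.difunctional hz hw hw', hz'⟩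
    · rintro y y' ⟨z, hz, hz'⟩
      obtain ⟨x, hx⟩ := s.right_total y
      obtain ⟨x', hx'⟩ := s.right_total y'
      have h : s.dom x x' :=
        e1 ▸ (⟨z, mul_rel_of_rel hx hz, mul_rel_of_rel hx' hz'⟩ : (s * t).dom x x')
      obtain ⟨w, hw, hw'⟩ := h
      exact ⟨x', s.difunctional hw' hw hx, hx'⟩
  exists_unit e := ⟨ofSetoid e, ofSetoid_dom e, ofSetoid_cod e⟩

/-- Any bijection between the quotient sets is a block bijection, so equivalences with equally many
classes are connected. -/
theorem exists_dom_eq_cod_eq {e f : Setoid (Fin n)}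
    (h : Nat.card (Quotient e) = Nat.card (Quotient f)) :
    ∃ α : DualSymInvMonoid n, α.dom = e ∧ α.cod = f := by
  let σ : Quotient e ≃ Quotient f := (Finite.equivFinOfCardEq h).trans (Finite.equivFin _).symm
  let α : DualSymInvMonoid n :=
    { rel := fun x y => σ (Quotient.mk e x) = Quotient.mk f y
      left_total := fun x => by
        obtain ⟨y, hy⟩ := Quotient.exists_rep (σ (Quotient.mk e x))
        exact ⟨y, hy.symm⟩
      right_total := fun y => by
        obtain ⟨x, hx⟩ := Quotient.exists_rep (σ.symm (Quotient.mk f y))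
        exact ⟨x, by rw [hx, Equiv.apply_symm_apply]⟩
      difunctional := fun h k m => h.trans (k.symm.trans m) }
  refine ⟨α, ?_, ?_⟩
  · ext x x'
    constructor
    · rintro ⟨y, h, h'⟩
      exact Quotient.exact (σ.injective (Eq.trans h (Eq.symm h')))
    · intro hx
      obtain ⟨y, hy⟩ := α.left_total x
      refine ⟨y, hy, ?_⟩
      have : Quotient.mk e x = Quotient.mk e x' := Quotient.sound hx
      exact (congrArg σ this.symm).trans hy
  · ext y y'
    constructor
    · rintro ⟨x, h, h'⟩
      exact Quotient.exact (Eq.trans (Eq.symm h) h')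
    · intro hy
      obtain ⟨x, hx⟩ := α.right_total y
      exact ⟨x, hx, Eq.trans hx (Quotient.sound hy)⟩

/-- The equivalence whose classes are the singletons of `B` and the complement of `B`. -/
def collapseCompl {X : Type*} [DecidableEq X] (B : Finset X) : Setoid X :=
  Setoid.ker fun x => if x ∈ B then some x else none

theorem card_quotient_collapseCompl {X : Type*} [DecidableEq X] {B : Finset X} {x₀ : X}
    (h : x₀ ∉ B) : Nat.card (Quotient (collapseCompl B)) = B.card + 1 := by
  have hr : Set.range (fun x => if x ∈ B then some x else none) =
      (Finset.insertNone B : Set (Option X)) := by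
    ext o
    rcases o with _ | x
    · simpa using ⟨x₀, h⟩
    · simp
  unfold collapseCompl
  rw [Nat.card_congr (Setoid.quotientKerEquivRange _), hr, Nat.card_eq_fintype_card]
  simp

theorem collapseCompl_rel {X : Type*} [DecidableEq X] {B : Finset X} {x₀ x : X} (h : x₀ ∉ B) :
    collapseCompl B x x₀ ↔ x ∉ B := by
  unfold collapseCompl
  rw [Setoid.ker_def, if_neg h]
  simp

/-- If e has k classes, then 1 < k < n + 1. Each (k - 1)-subset B of the nonzero points gives,
through `collapseCompl`, an equivalence with k classes, and B is recovered as the complement of the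
class of 0. There are C(n, k - 1) ≥ n such sets. -/
theorem le_ncard_card_quotient_eq {e : Setoid (Fin (n + 1))} (h1 : e ≠ ⊤) (h2 : e ≠ ⊥) :
    n ≤ {f : Setoid (Fin (n + 1)) | Nat.card (Quotient e) = Nat.card (Quotient f)}.ncard := by
  have := finite_setoid (n + 1)
  have hk1 : 1 < Nat.card (Quotient e) := by
    have : ∃ x y, ¬ e x y := by
      by_contra! hc
      exact h1 (top_le_iff.1 fun x y _ => hc x y)
    obtain ⟨x, y, hxy⟩ := this
    have h3 := Setoid.card_quotient_lt_of_le (le_top : e ≤ ⊤)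
      (trivial : (⊤ : Setoid (Fin (n + 1))) x y) hxy
    have h4 : 0 < Nat.card (Quotient (⊤ : Setoid (Fin (n + 1)))) :=
      have : Nonempty (Quotient (⊤ : Setoid (Fin (n + 1)))) := ⟨Quotient.mk _ 0⟩
      Nat.card_pos
    omega
  have hk2 : Nat.card (Quotient e) < n + 1 := by
    have : ∃ x y, e x y ∧ x ≠ y := by
      by_contra! hc
      exact h2 (le_bot_iff.1 fun x y h => hc x y h)
    obtain ⟨x, y, hxy, hne⟩ := this
    have h3 := Setoid.card_quotient_lt_of_le (bot_le : ⊥ ≤ e) hxy hne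
    have h4 : Nat.card (Quotient (⊥ : Setoid (Fin (n + 1)))) ≤ Nat.card (Fin (n + 1)) :=
      Nat.card_le_card_of_surjective (Quotient.mk _) Quotient.mk_surjective
    rw [Nat.card_fin] at h4
    omega
  have h3 : n ≤ n.choose (Nat.card (Quotient e) - 1) :=
    Nat.le_choose_of_pos_of_lt (by omega) (by omega)
  have h4 := Finset.card_powersetCard (Nat.card (Quotient e) - 1) ({0}ᶜ : Finset (Fin (n + 1)))
  rw [Finset.card_compl, Fintype.card_fin, Finset.card_singleton, Nat.add_sub_cancel] at h4
  rw [h4.symm, ← Set.ncard_coe_finset] at h3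
  refine h3.trans ?_
  have hmem : ∀ B ∈ Finset.powersetCard (Nat.card (Quotient e) - 1)
      ({0}ᶜ : Finset (Fin (n + 1))), 0 ∉ B ∧ B.card = Nat.card (Quotient e) - 1 := by
    intro B hB
    rw [Finset.mem_powersetCard] at hB
    exact ⟨fun h0 => by simpa using hB.1 h0, hB.2⟩
  refine Set.ncard_le_ncard_of_injOn collapseCompl ?_ ?_ (Set.toFinite _)
  · intro B hB
    obtain ⟨h0, hB⟩ := hmem B hB
    rw [Set.mem_ofPred_eq, card_quotient_collapseCompl h0, hB]
    omega
  · intro B hB B' hB' h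
    ext x
    rw [← not_iff_not, ← collapseCompl_rel (hmem B hB).1, h, collapseCompl_rel (hmem B' hB').1]

/-- The equivalence whose only possibly non-trivial class is `{a, b}`. -/
def merge {X : Type*} (a b : X) : Setoid X where
  r x y := x = y ∨ (x = a ∨ x = b) ∧ (y = a ∨ y = b)
  iseqv := by
    refine ⟨fun x => Or.inl rfl, fun h => h.imp Eq.symm And.symm, ?_⟩
    rintro x y z (rfl | h) (rfl | k)
    · exact Or.inl rfl
    · exact Or.inr k
    · exact Or.inr h
    · exact Or.inr ⟨h.1, k.2⟩

theorem merge_rel {X : Type*} {a b x y : X} :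
    merge a b x y ↔ x = y ∨ (x = a ∨ x = b) ∧ (y = a ∨ y = b) := Iff.rfl

theorem merge_right_injective {X : Type*} (a : X) :
    Function.Injective (merge a : X → Setoid X) := by
  intro b c h
  have h1 : merge a c a b := h ▸ Or.inr ⟨Or.inl rfl, Or.inr rfl⟩
  have h2 : merge a b a c := h ▸ Or.inr ⟨Or.inl rfl, Or.inr rfl⟩
  rw [merge_rel] at h1 h2
  grind

theorem dom_ofSetoid_mul {e : Setoid (Fin n)} {α : DualSymInvMonoid n} (hα : α.dom = ⊥) :
    (ofSetoid e * α).dom = e := by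
  refine le_antisymm ?_ ?_
  · rintro x x' ⟨z, h, h'⟩
    rw [mul_rel_iff_of_le (hα ▸ bot_le)] at h h'
    obtain ⟨y, h1, h2⟩ := h
    obtain ⟨y', h1', h2'⟩ := h'
    have hy : (⊥ : Setoid (Fin n)) y y' := hα ▸ (⟨z, h2, h2'⟩ : α.dom y y')
    have hy : y = y' := hy
    subst hy
    exact e.trans h1 (e.symm h1')
  · conv_lhs => rw [← ofSetoid_dom e]
    exact dom_le_dom_mul _ _

theorem exists_injective_of_dom_cod_eq_bot {α : DualSymInvMonoid n} (hd : α.dom = ⊥)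
    (hc : α.cod = ⊥) :
    ∃ g : Fin n → Fin n, Function.Injective g ∧ ∀ x y, α.rel x y ↔ y = g x := by
  choose g hg using α.left_total
  refine ⟨g, fun x x' h => ?_, fun x y => ⟨fun h => ?_, fun h => h ▸ hg x⟩⟩
  · have : (⊥ : Setoid (Fin n)) x x' := hd ▸ (⟨g x, hg x, h ▸ hg x'⟩ : α.dom x x')
    exact this
  · have : (⊥ : Setoid (Fin n)) y (g x) := hc ▸ (⟨x, h, hg x⟩ : α.cod y (g x))
    exact this

/-- A permutation is determined by its values up to exchanging two of them, together with the
order of these two. -/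
theorem eq_of_ofSetoid_merge_mul_eq {a b : Fin n} {α β : DualSymInvMonoid n} (hd : α.dom = ⊥)
    (hc : α.cod = ⊥) (hd' : β.dom = ⊥) (hc' : β.cod = ⊥)
    (h : ofSetoid (merge a b) * α = ofSetoid (merge a b) * β)
    (hlt : (∃ x y, α.rel a x ∧ α.rel b y ∧ x < y) ↔ (∃ x y, β.rel a x ∧ β.rel b y ∧ x < y)) :
    α = β := by
  have key : ∀ x z, (∃ y, merge a b x y ∧ α.rel y z) ↔ ∃ y, merge a b x y ∧ β.rel y z := by
    intro x z
    have := congrArg (fun γ => γ.rel x z) h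
    simp only [eq_iff_iff] at this
    rwa [mul_rel_iff_of_le (hd ▸ bot_le), mul_rel_iff_of_le (hd' ▸ bot_le)] at this
  obtain ⟨f, hf, hαf⟩ := exists_injective_of_dom_cod_eq_bot hd hc
  obtain ⟨g, hg, hβg⟩ := exists_injective_of_dom_cod_eq_bot hd' hc'
  simp only [hαf, hβg, merge_rel] at key hlt
  suffices hfg : ∀ x, f x = g x by
    refine ext_iff' fun x y => ?_
    rw [hαf, hβg, hfg]
  have hlt : f a < f b ↔ g a < g b := by simpa using hlt
  have k1 : f a = g a ∨ f a = g b := by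
    obtain ⟨y, hy, hy'⟩ := (key a (f a)).1 ⟨a, Or.inl rfl, rfl⟩
    grind
  have k2 : f b = g a ∨ f b = g b := by
    obtain ⟨y, hy, hy'⟩ := (key b (f b)).1 ⟨b, Or.inl rfl, rfl⟩
    grind
  -- The product leaves only the possibility that the two values are swapped, which `hlt` rules out.
  have k3 : f a = g a ∧ f b = g b := by
    by_cases hab : a = b
    · subst hab
      grind
    · have h1 := hf.ne hab
      have h2 := hg.ne hab
      grind
  intro x
  by_cases hxa : x = a
  · rw [hxa, k3.1]
  by_cases hxb : x = b
  · rw [hxb, k3.2]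
  obtain ⟨y, hy, hy'⟩ := (key x (f x)).1 ⟨x, Or.inl rfl, rfl⟩
  grind

theorem eq_of_dom_eq_top {α β : DualSymInvMonoid n} (hα : α.dom = ⊤) (hβ : β.dom = ⊤) :
    α = β := by
  have key : ∀ γ : DualSymInvMonoid n, γ.dom = ⊤ → ∀ x y, γ.rel x y := by
    intro γ hγ x y
    obtain ⟨x', hx'⟩ := γ.right_total y
    obtain ⟨w, hw, hw'⟩ : γ.dom x x' := hγ ▸ trivial
    exact γ.difunctional hw hw' hx'
  exact ext_iff' fun x y => iff_of_true (key α hα x y) (key β hβ x y)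

/-- The exceptional objects are ⊤, with a single loop, and ⊥, whose loops are the permutations. The
4 counts |S| once for the other objects, once for ⊤, and twice for ⊥. -/
theorem mul_ncard_loops_grading_le (n : ℕ) :
    n * (grading (n + 1)).loops.ncard ≤ 4 * Nat.card (DualSymInvMonoid (n + 1)) := by
  classical
  have h0 := (grading (n + 1)).mul_ncard_loops_le n {⊤, ⊥} (by
    intro e he
    simp only [Set.mem_insert_iff, Set.mem_singleton_iff, not_or] at he
    convert le_ncard_card_quotient_eq he.1 he.2 using 2
    ext f
    constructor
    · rintro ⟨s, rfl, rfl⟩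
      exact s.card_quotient_cod.symm
    · exact fun h => exists_dom_eq_cod_eq h)
  have h1 : {s | s ∈ (grading (n + 1)).loops ∧
      (grading (n + 1)).d s ∈ ({⊤, ⊥} : Set (Setoid (Fin (n + 1))))} ⊆
      {s | s.dom = ⊤} ∪ {s | s.dom = ⊥ ∧ s.cod = ⊥} := by
    rintro s ⟨hs, hs' | hs'⟩
    · exact Or.inl hs'
    · exact Or.inr ⟨hs', (Eq.symm hs).trans hs'⟩
  have h2 : {s : DualSymInvMonoid (n + 1) | s.dom = ⊤}.ncard ≤ 1 := by
    rw [Set.ncard_le_one (Set.toFinite _)]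
    exact fun s hs t ht => eq_of_dom_eq_top hs ht
  have h3 : n + 1 ≤ Nat.card (DualSymInvMonoid (n + 1)) := by
    have := Nat.card_le_card_of_injective
      (fun i : Fin (n + 1) => ofSetoid (merge (0 : Fin (n + 1)) i)) (by
      intro i j h
      have := congrArg dom h
      simp only [ofSetoid_dom] at this
      exact merge_right_injective _ this)
    rwa [Nat.card_fin] at this
  -- Merging 0 with i before applying a permutation forgets only which of the two values belongs to
  -- 0; a Boolean records this, whence the factor 2.
  have h4 : (n + 1) * {s : DualSymInvMonoid (n + 1) | s.dom = ⊥ ∧ s.cod = ⊥}.ncard ≤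
      Nat.card (DualSymInvMonoid (n + 1)) * 2 := by
    have := Nat.card_le_card_of_injective
      (fun q : Fin (n + 1) × {s : DualSymInvMonoid (n + 1) | s.dom = ⊥ ∧ s.cod = ⊥} =>
        (ofSetoid (merge 0 q.1) * q.2.1,
          decide (∃ x y, q.2.1.rel 0 x ∧ q.2.1.rel q.1 y ∧ x < y))) (by
      rintro ⟨i, s, hs, hs'⟩ ⟨j, t, ht, ht'⟩ h
      simp only [Prod.mk.injEq, decide_eq_decide] at h
      obtain ⟨h, hlt⟩ := h
      have hij : i = j := by
        have := congrArg dom h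
        rw [dom_ofSetoid_mul hs, dom_ofSetoid_mul ht] at this
        exact merge_right_injective _ this
      subst hij
      have := eq_of_ofSetoid_merge_mul_eq hs hs' ht ht' h hlt
      subst this
      rfl)
    rw [Nat.card_prod, Nat.card_prod, Nat.card_fin] at this
    simpa using this
  have h5 := (Set.ncard_le_ncard h1 (Set.toFinite _)).trans (Set.ncard_union_le _ _)
  have h6 := Nat.mul_le_mul_left n (h5.trans (Nat.add_le_add_right h2 _))
  rw [mul_add] at h6
  rw [add_mul] at h4
  omega

theorem tendsto_semigroupLength :
    Tendsto (fun n : ℕ =>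
        (semigroupLength (DualSymInvMonoid n) : ℝ) / (Nat.card (DualSymInvMonoid n) : ℝ))
      atTop (𝓝 (1 / 2)) := by
  have := finite_setoid
  refine tendsto_semigroupLength_div_card grading 4 fun n => ?_
  exact le_trans (Nat.mul_le_mul_right _ (by omega)) (mul_ncard_loops_grading_le (n + 2))

end DualSymInvMonoid

theorem mainTheorem6 :
    Tendsto (fun n : ℕ => (semigroupLength (SymInvMonoid n) : ℝ) / (Nat.card (SymInvMonoid n) : ℝ))
      atTop (𝓝 (1 / 2)) ∧
    Tendsto (fun n : ℕ =>
        (semigroupLength (DualSymInvMonoid n) : ℝ) / (Nat.card (DualSymInvMonoid n) : ℝ))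
      atTop (𝓝 (1 / 2)) ∧
    Tendsto (fun n : ℕ => (semigroupLength (POI n) : ℝ) / (Nat.card (POI n) : ℝ))
      atTop (𝓝 (1 / 2)) ∧
    Tendsto (fun n : ℕ => (semigroupLength (POPI n) : ℝ) / (Nat.card (POPI n) : ℝ))
      atTop (𝓝 (1 / 2)) := by

  exact ⟨tendsto_semigroupLength_symInvMonoid, DualSymInvMonoid.tendsto_semigroupLength,
    tendsto_semigroupLength_submonoid POI (fun _ _ hf => SymInvMonoid.symm_mem_POI hf)
      (fun _ => le_rfl),
    tendsto_semigroupLength_submonoid POPI (fun _ _ hf => symm_mem_POPI hf) POI_le_POPI⟩
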